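/- All graphs are finite, simple and undirected. A graph $G$ is $k$-vertex-critical if $\chi(G)=k$ and $\chi(G-v)<k$ for every vertex $v$ of $G$; it is $(H_1,H_2)$-free if no induced subgraph of $G$ is isomorphic to $H_1$ or to $H_2$. $P_t$ denotes the path on $t$ vertices, $+$ denotes disjoint union, $\overline{G}$ is the complement of $G$, and the gem is the graph obtained from $P_4$ by adding a vertex adjacent to all four vertices of the path. Graphs are counted up to isomorphism and given by adjacency lists. (a) There are exactly 3 four-vertex-critical $(P_5,\text{gem})$-free graphs, namely 1. $\{0: 1\,2\,3;\ 1: 0\,2\,3;\ 2: 0\,1\,3;\ 3: 0\,1\,2\}$ (that is, $K_4$); 2. $\{0: 1\,4\,5;\ 1: 0\,2\,5\,6;\ 2: 1\,3\,6;\ 3: 2\,4\,6;\ 4: 0\,3\,5;\ 5: 0\,1\,4;\ 6: 1\,2\,3\}$; 3. $\{0: 1\,4\,5;\ 1: 0\,2\,5\,6\,7;\ 2: 1\,3\,7;\ 3: 2\,4\,6;\ 4: 0\,3\,5\,6\,7;\ 5: 0\,1\,4;\ 6: 1\,3\,4\,8\,9;\ 7: 1\,2\,4\,8\,9;\ 8: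 6\,7\,9;\ 9: 6\,7\,8\}$. (b) There are exactly 6 four-vertex-critical $(P_5,\overline{P_3+P_2})$-free graphs, namely 1. $\{0: 1\,2\,3;\ 1: 0\,2\,3;\ 2: 0\,1\,3;\ 3: 0\,1\,2\}$ (that is, $K_4$); 2. $\{0: 1\,4\,5;\ 1: 0\,2\,5;\ 2: 1\,3\,5;\ 3: 2\,4\,5;\ 4: 0\,3\,5;\ 5: 0\,1\,2\,3\,4\}$; 3. $\{0: 1\,4\,5;\ 1: 0\,2\,5\,6;\ 2: 1\,3\,6;\ 3: 2\,4\,6;\ 4: 0\,3\,5;\ 5: 0\,1\,4;\ 6: 1\,2\,3\}$; 4. $\{0: 1\,4\,5\,6;\ 1: 0\,2\,5\,6;\ 2: 1\,3\,5;\ 3: 2\,4\,6;\ 4: 0\,3\,5;\ 5: 0\,1\,2\,4;\ 6: 0\,1\,3\}$; 5. $\{0: 1\,4\,5\,6;\ 1: 0\,2\,5\,6;\ 2: 1\,3\,5\,6;\ 3: 2\,4\,6;\ 4: 0\,3\,5;\ 5: 0\,1\,2\,4;\ 6: 0\,1\,2\,3\}$; 6. $\{0: 1\,4\,5\,6;\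 1: 0\,2\,5\,6;\ 2: 1\,3\,6;\ 3: 2\,4\,6;\ 4: 0\,3\,5;\ 5: 0\,1\,4;\ 6: 0\,1\,2\,3\}$. -/

import Mathlib

namespace VertexCritical

/-- `G` is `k`-vertex-critical: `χ(G) = k` and `χ(G - v) < k` for every vertex `v`. -/
def IsVertexCritical {V : Type*} (G : SimpleGraph V) (k : ℕ) : Prop :=
  G.chromaticNumber = k ∧ ∀ v : V, (G.induce ({v}ᶜ : Set V)).chromaticNumber < k

/-- `G` is `H`-free: no induced subgraph of `G` is isomorphic to `H`. -/
def IsFree {V W : Type*} (H : SimpleGraph W) (G : SimpleGraph V) : Prop :=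
  ¬ H.IsIndContained G

/-- The graph on `{0, …, n - 1}` with the given adjacency lists (all lists used below are
symmetric and loopless). -/
def ofAdjLists {n : ℕ} (adj : Fin n → List (Fin n)) : SimpleGraph (Fin n) :=
  SimpleGraph.fromRel fun i j => j ∈ adj i

/-- The path on five vertices. -/
abbrev P5 : SimpleGraph (Fin 5) := SimpleGraph.pathGraph 5

/-- The gem: the path `0 - 1 - 2 - 3` together with a vertex `4` adjacent to all of it. -/
def gem : SimpleGraph (Fin 5) :=
  ofAdjLists ![[1, 4], [0, 2, 4], [1, 3, 4], [2, 4], [0, 1, 2, 3]]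

/-- The complement of the disjoint union of a path on three and a path on two vertices. -/
def coP3P2 : SimpleGraph (Fin 3 ⊕ Fin 2) :=
  (SimpleGraph.pathGraph 3 ⊕g SimpleGraph.pathGraph 2)ᶜ

/-- Finite graphs with vertex set `{0, …, n - 1}`, for any `n`. -/
abbrev FinGraph : Type := Σ n : ℕ, SimpleGraph (Fin n)

/-- Graph isomorphism as an equivalence relation. -/
instance isoSetoid : Setoid FinGraph where
  r G H := Nonempty (G.2 ≃g H.2)
  iseqv :=
    { refl := fun _ => ⟨SimpleGraph.Iso.refl⟩
      symm := fun ⟨e⟩ => ⟨e.symm⟩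
      trans := fun ⟨e⟩ ⟨f⟩ => ⟨e.trans f⟩ }

/-- The set of isomorphism classes of finite `k`-vertex-critical `(P₅, H)`-free graphs. -/
def criticalClasses {W : Type*} (k : ℕ) (H : SimpleGraph W) : Set (Quotient isoSetoid) :=
  {c | ∃ G : FinGraph, IsVertexCritical G.2 k ∧ IsFree P5 G.2 ∧ IsFree H G.2 ∧ c = ⟦G⟧}

/-- The three listed 4-vertex-critical `(P₅, gem)`-free graphs. -/
def gemList : List FinGraph :=
  [⟨4, ofAdjLists ![[1, 2, 3], [0, 2, 3], [0, 1, 3], [0, 1, 2]]⟩,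
   ⟨7, ofAdjLists ![[1, 4, 5], [0, 2, 5, 6], [1, 3, 6], [2, 4, 6], [0, 3, 5], [0, 1, 4],
      [1, 2, 3]]⟩,
   ⟨10, ofAdjLists ![[1, 4, 5], [0, 2, 5, 6, 7], [1, 3, 7], [2, 4, 6], [0, 3, 5, 6, 7],
      [0, 1, 4], [1, 3, 4, 8, 9], [1, 2, 4, 8, 9], [6, 7, 9], [6, 7, 8]]⟩]

/-- The six listed 4-vertex-critical `(P₅, co-(P₃ + P₂))`-free graphs. -/
def coP3P2List : List FinGraph :=
  [⟨4, ofAdjLists ![[1, 2, 3], [0, 2, 3], [0, 1, 3], [0, 1, 2]]⟩,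
   ⟨6, ofAdjLists ![[1, 4, 5], [0, 2, 5], [1, 3, 5], [2, 4, 5], [0, 3, 5], [0, 1, 2, 3, 4]]⟩,
   ⟨7, ofAdjLists ![[1, 4, 5], [0, 2, 5, 6], [1, 3, 6], [2, 4, 6], [0, 3, 5], [0, 1, 4],
      [1, 2, 3]]⟩,
   ⟨7, ofAdjLists ![[1, 4, 5, 6], [0, 2, 5, 6], [1, 3, 5], [2, 4, 6], [0, 3, 5], [0, 1, 2, 4],
      [0, 1, 3]]⟩,
   ⟨7, ofAdjLists ![[1, 4, 5, 6], [0, 2, 5, 6], [1, 3, 5, 6], [2, 4, 6], [0, 3, 5],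
      [0, 1, 2, 4], [0, 1, 2, 3]]⟩,
   ⟨7, ofAdjLists ![[1, 4, 5, 6], [0, 2, 5, 6], [1, 3, 6], [2, 4, 6], [0, 3, 5], [0, 1, 4],
      [0, 1, 2, 3]]⟩]

end VertexCritical

/-! A graph is 4-vertex-critical iff it has no 3-colouring but every vertex-deleted subgraph has one
(`isVertexCritical_four_iff`). If such a graph contains an induced copy of a graph without
3-colouring, the copy is the whole graph (`IsCritical.nonempty_iso`). So it suffices to show that
every critical graph `G` avoiding the two forbidden graphs contains a listed graph. Suppose that it
contains none.

Let `H` be an induced subgraph of `G`, and let `L` be a list containing the trace (neighbourhood in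
`H`) of every vertex outside `H`. Traces that would complete a forbidden graph or a `K₄` are removed
from `L`. Criticality demands further vertices: no neighbourhood lies in another one, all degrees
are at least three, no edge folds onto a disjoint edge, and a nonempty 3-colourable part has a
neighbour outside. Where `H` by itself violates such a condition, some outside vertex must have its
trace in a definite sublist of `L`. If that sublist is empty, this is a contradiction. Otherwise
take a trace `t` in a shortest sublist: either some vertex has trace `t` and is added to `H`, or
none has and `t` leaves `L`. A branch also closes when `H` contains a listed graph.

By `search_sound` a closed search tree refutes the existence of `G`, and the kernel evaluates the
trees. One starts at an induced 5-cycle, where traces can be discarded up to rotation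
(`cycleSearch_sound`). The other starts at a single vertex, with the 5-cycle as a further forbidden
graph. Conversely, finite checks (`checkFamily_gem`, `checkFamily_coP3P2`) show that the listed
graphs are critical, avoid the forbidden graphs and are pairwise non-isomorphic. -/

namespace VertexCritical

/-! ### Encoding induced subgraphs by bit masks

The functions below are evaluated by the kernel; therefore they use the operations on `ℕ` that the
kernel implements directly, and the innermost loops are written with recursors. -/

noncomputable section

/-- The bit mask of the entries of a list that satisfy a predicate. -/
def mask {V : Type*} (p : V → Bool) : List V → ℕ
  | [] => 0
  | v :: vs => Nat.bit (p v) (mask p vs)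

/-- The masks of the neighbours and of the non-neighbours of `v` in `vs`. -/
def row {V : Type*} [DecidableEq V] (G : SimpleGraph V) [DecidableRel G.Adj] (vs : List V)
    (v : V) : ℕ × ℕ :=
  (mask (fun x => decide (G.Adj v x)) vs, mask (fun x => decide (v ≠ x ∧ ¬ G.Adj v x)) vs)

/-- The subgraph induced on a list of vertices, encoded by the rows of its vertices. -/
def code {V : Type*} [DecidableEq V] (G : SimpleGraph V) [DecidableRel G.Adj] (vs : List V) :
    List (ℕ × ℕ) :=
  vs.map (row G vs)

/-- The `i`-th bit of `t`. -/
def bit (t i : ℕ) : Bool := Nat.beq (Nat.land (Nat.shiftRight t i) 1) 1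

/-- Whether `a` is a submask of `b`. -/
def submask (a b : ℕ) : Bool := Nat.beq (Nat.land a b) a

/-- Update the old rows for a new vertex with bit `b` and trace `t`. -/
def extendRows (b : ℕ) : List (ℕ × ℕ) → ℕ → List (ℕ × ℕ)
  | [], _ => []
  | r :: rs, t =>
    bif bit t 0 then (Nat.add r.1 b, r.2) :: extendRows b rs (Nat.div t 2)
    else (r.1, Nat.add r.2 b) :: extendRows b rs (Nat.div t 2)

/-- The mask of the first `n` vertices. -/
def fullMask (n : ℕ) : ℕ := Nat.sub (Nat.pow 2 n) 1

/-- The encoded graph on `n + 1` vertices obtained by adding a vertex with trace `t`. -/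
def extend (n : ℕ) (h : List (ℕ × ℕ)) (t : ℕ) : List (ℕ × ℕ) :=
  extendRows (Nat.pow 2 n) h t ++ [(t, Nat.xor t (fullMask n))]

/-- Apply `f` to the rows selected by the mask `c` and to their bits, and join the results. -/
def bindRows (f : ℕ × ℕ → ℕ → List (ℕ × ℕ)) (h : List (ℕ × ℕ)) : ℕ → ℕ → List (ℕ × ℕ) :=
  List.rec (fun _ _ => []) (fun r _ ih c b =>
    bif Nat.beq c 0 then [] else
    bif Nat.beq (Nat.land c 1) 1 then f r b ++ ih (Nat.div c 2) (Nat.mul 2 b)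
    else ih (Nat.div c 2) (Nat.mul 2 b)) h

/-- The vertices selected by `c` whose adjacencies to the vertices with the given rows are given
by `s`. -/
def candidates (s : List Bool) : List (ℕ × ℕ) → ℕ → ℕ :=
  List.rec (fun _ c => c) (fun b _ ih rs c =>
    List.rec 0 (fun r rs _ => ih rs (Nat.land c (Bool.rec r.2 r.1 b))) rs) s

/-- All extensions of the vertices with rows `acc` to an induced copy of a pattern, with the
first new vertex in `c`. A copy is recorded by the masks of the vertices that are (are not)
to be adjacent to the root. -/
def copies (h : List (ℕ × ℕ)) (full : ℕ) (P : List (Bool × List Bool)) :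
    List (ℕ × ℕ) → ℕ → ℕ → ℕ → List (ℕ × ℕ) :=
  List.rec (fun _ _ pos neg => [(pos, neg)]) (fun s _ ih acc c pos neg =>
    bindRows (fun r b =>
      bif s.1 then ih (r :: acc) full (Nat.lor pos b) neg
      else ih (r :: acc) full pos (Nat.lor neg b)) h (candidates s.2 acc c) 1) P

/-- The pattern formed by the vertices `ps` after the vertices `acc`: for each vertex its adjacency
to the root and to the preceding vertices, the most recent one first. -/
def pattern {W : Type*} (adj : W → W → Bool) (root : W) :
    List W → List W → List (Bool × List Bool)
  | [], _ => []
  | p :: ps, acc => (adj root p, acc.map (adj p)) :: pattern adj root ps (p :: acc)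

/-- The pattern of a graph given by adjacency lists. -/
def listPattern {n : ℕ} (l : Fin n → List (Fin n)) (root : Fin n) (ps : List (Fin n)) :
    List (Bool × List Bool) :=
  pattern (fun i j => decide (j ∈ l i)) root ps []

/-- Whether the rows can be coloured with three colours, given the colour classes of the preceding
rows and the bit of the first row. -/
def colorable : List (ℕ × ℕ) → ℕ → ℕ → ℕ → ℕ → Bool
  | [], _, _, _, _ => true
  | r :: rs, b, x, y, z =>
    -- The bit `b` is new to all three colour classes, so addition inserts it.
    (Nat.beq (Nat.land r.1 x) 0 && colorable rs (Nat.mul 2 b) (Nat.add x b) y z) ||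
    (Nat.beq (Nat.land r.1 y) 0 && colorable rs (Nat.mul 2 b) x (Nat.add y b) z) ||
    (Nat.beq (Nat.land r.1 z) 0 && colorable rs (Nat.mul 2 b) x y (Nat.add z b))

/-! ### The search -/

/-- The number of entries of a list that are selected by a mask. -/
def popcount {α : Type*} : List α → ℕ → ℕ
  | [], _ => 0
  | _ :: l, m => Nat.add (Nat.mod m 2) (popcount l (Nat.div m 2))

/-- For vertices `u ≠ v` with `N(u) ⊆ N(v)`: the traces that contain `u` but not `v`. -/
def domObs (k : List ((ℕ × ℕ) × ℕ)) (L : List ℕ) : List (List ℕ) :=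
  k.flatMap fun u => k.flatMap fun v =>
    bif submask u.1.1 v.1.1 && !Nat.beq u.2 v.2 then
      [L.filter fun t => bit t u.2 && !bit t v.2] else []

/-- For vertices `u` of degree at most two: the traces that contain `u`. -/
def degObs (k : List ((ℕ × ℕ) × ℕ)) (L : List ℕ) : List (List ℕ) :=
  k.flatMap fun u =>
    bif Nat.ble (popcount k u.1.1) 2 then [L.filter fun t => bit t u.2] else []

/-- For disjoint edges `ab` and `cd` with `N(a) ⊆ N(c) ∪ {b}` and `N(b) ⊆ N(d) ∪ {a}`: the traces
that contain `a` but not `c`, or `b` but not `d`. -/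
def homObs (k : List ((ℕ × ℕ) × ℕ)) (L : List ℕ) : List (List ℕ) :=
  k.flatMap fun a => k.flatMap fun b =>
    bif bit a.1.1 b.2 && Nat.blt a.2 b.2 then
      k.flatMap fun c =>
        bif submask a.1.1 (Nat.lor c.1.1 (Nat.pow 2 b.2)) && !Nat.beq a.2 c.2 &&
            !Nat.beq b.2 c.2 then
          k.flatMap fun d =>
            bif submask b.1.1 (Nat.lor d.1.1 (Nat.pow 2 a.2)) && bit c.1.1 d.2 &&
                !Nat.beq a.2 d.2 && !Nat.beq b.2 d.2 then
              [L.filter fun t => (bit t a.2 && !bit t c.2) || (bit t b.2 && !bit t d.2)]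
            else []
        else []
    else []

/-- If the graph is three-colourable: the nonempty traces. -/
def restObs (h : List (ℕ × ℕ)) (L : List ℕ) : List (List ℕ) :=
  bif !h.isEmpty && colorable h 1 0 0 0 then [L.filter fun t => !Nat.beq t 0] else []

/-- Lists of traces, each of which has to contain the trace of a vertex of a critical graph. -/
def allObs (h : List (ℕ × ℕ)) (L : List ℕ) : List (List ℕ) :=
  let k := h.zipIdx
  let O := domObs k L ++ degObs k L ++ restObs h L
  -- Folding edges takes four nested loops, so it is tried only if no other list already closes the
  -- branch or leaves a single trace.
  bif O.any fun o => Nat.ble o.length 1 then O else homObs k L ++ O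

/-- A shortest one among `o` and the given lists. -/
def shortest : List (List ℕ) → List ℕ → List ℕ
  | [], o => o
  | o' :: os, o => shortest os (bif Nat.blt o'.length o.length then o' else o)

/-- The copies of the patterns `F`, minus their roots, with the first vertex in `c`. -/
def constraints (F : List (List (Bool × List Bool))) (h : List (ℕ × ℕ)) (full c : ℕ) :
    List (ℕ × ℕ) :=
  F.flatMap fun P => copies h full P [] c 0 0

/-- The traces that do not complete a copy to a forbidden graph. -/
def traces (C : List (ℕ × ℕ)) (L : List ℕ) : List ℕ :=
  L.filter fun t => C.all fun q => !(submask q.1 t && Nat.beq (Nat.land t q.2) 0)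

/-- The possible traces after a vertex with trace `t` has been added. -/
def nextTraces (F : List (List (Bool × List Bool))) (n : ℕ) (h : List (ℕ × ℕ)) (t : ℕ)
    (L : List ℕ) : List ℕ :=
  -- Only copies whose first vertex is the new one are needed: the others have been used at earlier
  -- stages.
  traces (constraints F (extend n h t) (fullMask (Nat.succ n)) (Nat.pow 2 n))
    (L.flatMap fun s => [s, Nat.add s (Nat.pow 2 n)])

/-- Whether the graph contains one of the patterns `T`. -/
def containsSome (T : List (List (Bool × List Bool))) (n : ℕ) (h : List (ℕ × ℕ)) : Bool :=
  T.any fun P => Nat.ble P.length n && !(copies h (fullMask n) P [] (fullMask n) 0 0).isEmpty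

/-- Search for critical graphs that contain the graph `h` on `n` vertices, avoid the rooted
patterns `F` and the patterns `T`, and in which all other vertices have traces in `L`. -/
def search (F T : List (List (Bool × List Bool))) : ℕ → ℕ → List (ℕ × ℕ) → List ℕ → Bool
  | 0, _, _, _ => false
  | k + 1, n, h, L =>
    -- The graphs `T` are assumed absent, so their appearance closes the branch.
    containsSome T n h ||
    match allObs h L with
    | [] => false
    | o :: os =>
      match shortest os o with
      | [] => true
      | t :: _ =>
        -- Some vertex has trace `t` and is added; in the other branch no vertex has trace `t`.
        search F T k (Nat.succ n) (extend n h t) (nextTraces F n h t L) &&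
        search F T k n h (L.erase t)

/-- The trace on a 5-cycle after turning the cycle. -/
def turn (t : ℕ) : ℕ := Nat.add (Nat.div t 2) (Nat.mul 16 (Nat.mod t 2))

/-- The adjacency lists of the 5-cycle. -/
def cycleAdj : Fin 5 → List (Fin 5) := ![[1, 4], [0, 2], [1, 3], [2, 4], [0, 3]]

/-- The code of the 5-cycle. -/
def cycleCode : List (ℕ × ℕ) := [(18, 12), (5, 24), (10, 17), (20, 3), (9, 6)]

/-- The search started at a 5-cycle; traces are discarded together with their rotations. -/
def cycleSearch (F T : List (List (Bool × List Bool))) : ℕ → List ℕ → Bool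
  | 0, _ => false
  | k + 1, L =>
    match allObs cycleCode L with
    | [] => false
    | o :: os =>
      match shortest os o with
      | [] => true
      | t :: _ =>
        search F T 100 6 (extend 5 cycleCode t) (nextTraces F 5 cycleCode t L) &&
        cycleSearch F T k (L.filter fun s => !(Nat.beq s t || Nat.beq (turn s) t ||
          Nat.beq (turn (turn s)) t || Nat.beq (turn (turn (turn s))) t ||
          Nat.beq (turn (turn (turn (turn s)))) t))

end

/-! ### The patterns -/

noncomputable section

/-- The adjacency lists of the path on five vertices. -/
def pathAdj : Fin 5 → List (Fin 5) := ![[1], [0, 2], [1, 3], [2, 4], [3]]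

/-- The adjacency lists of the gem. -/
def gemAdj : Fin 5 → List (Fin 5) := ![[1, 4], [0, 2, 4], [1, 3, 4], [2, 4], [0, 1, 2, 3]]

/-- The adjacency lists of the complement of `P₃ + P₂`. -/
def coP3P2Adj : Fin 5 → List (Fin 5) := ![[2, 3, 4], [3, 4], [0, 3, 4], [0, 1, 2], [0, 1, 2]]

/-- The adjacency lists of the complete graph on four vertices. -/
def completeAdj : Fin 4 → List (Fin 4) := ![[1, 2, 3], [0, 2, 3], [0, 1, 3], [0, 1, 2]]

/-- The adjacency lists of the wheel with five spokes. -/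
def wheelAdj : Fin 6 → List (Fin 6) :=
  ![[1, 4, 5], [0, 2, 5], [1, 3, 5], [2, 4, 5], [0, 3, 5], [0, 1, 2, 3, 4]]

/-- The adjacency lists of the Moser spindle. -/
def spindleAdj : Fin 7 → List (Fin 7) :=
  ![[1, 4, 5], [0, 2, 5, 6], [1, 3, 6], [2, 4, 6], [0, 3, 5], [0, 1, 4], [1, 2, 3]]

/-- The adjacency lists of the critical graph on ten vertices. -/
def tenAdj : Fin 10 → List (Fin 10) :=
  ![[1, 4, 5], [0, 2, 5, 6, 7], [1, 3, 7], [2, 4, 6], [0, 3, 5, 6, 7],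
    [0, 1, 4], [1, 3, 4, 8, 9], [1, 2, 4, 8, 9], [6, 7, 9], [6, 7, 8]]

/-- The adjacency lists of a critical graph on seven vertices. -/
def crossedAdj : Fin 7 → List (Fin 7) :=
  ![[1, 4, 5, 6], [0, 2, 5, 6], [1, 3, 5], [2, 4, 6], [0, 3, 5], [0, 1, 2, 4], [0, 1, 3]]

/-- The adjacency lists of the critical graph on seven vertices with thirteen edges. -/
def denseAdj : Fin 7 → List (Fin 7) :=
  ![[1, 4, 5, 6], [0, 2, 5, 6], [1, 3, 5, 6], [2, 4, 6], [0, 3, 5], [0, 1, 2, 4], [0, 1, 2, 3]]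

/-- The adjacency lists of a critical graph on seven vertices. -/
def fannedAdj : Fin 7 → List (Fin 7) :=
  ![[1, 4, 5, 6], [0, 2, 5, 6], [1, 3, 6], [2, 4, 6], [0, 3, 5], [0, 1, 4], [0, 1, 2, 3]]

/-- Orders of the vertices of the path,
one for each choice of the first two up to symmetry. -/
def pathOrders : List (Fin 5 × List (Fin 5)) :=
  -- The root stands for a vertex outside the current graph, the next entry for the vertex added
  -- last.
  [(0, [1, 2, 3, 4]), (0, [2, 1, 3, 4]), (0, [3, 2, 1, 4]), (0, [4, 3, 2, 1]),
   (1, [0, 2, 3, 4]), (1, [2, 3, 4, 0]), (1, [3, 2, 4, 0]), (1, [4, 3, 2, 0]),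
   (2, [0, 1, 3, 4]), (2, [1, 0, 3, 4])]

/-- Orders of the vertices of the gem,
one for each choice of the first two up to symmetry. -/
def gemOrders : List (Fin 5 × List (Fin 5)) :=
  [(0, [1, 4, 2, 3]), (0, [2, 1, 4, 3]), (0, [3, 4, 2, 1]), (0, [4, 1, 2, 3]),
   (1, [0, 4, 2, 3]), (1, [2, 4, 3, 0]), (1, [3, 2, 4, 0]), (1, [4, 0, 2, 3]),
   (4, [0, 1, 2, 3]), (4, [1, 0, 2, 3])]

/-- Orders of the vertices of the complement of `P₃ + P₂`,
one for each choice of the first two up to symmetry. -/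
def coP3P2Orders : List (Fin 5 × List (Fin 5)) :=
  [(0, [1, 3, 2, 4]), (0, [2, 3, 4, 1]), (0, [3, 2, 4, 1]), (1, [0, 3, 2, 4]),
   (1, [3, 0, 2, 4]), (3, [0, 2, 4, 1]), (3, [1, 4, 0, 2]), (3, [4, 0, 2, 1])]

/-- Orders of the vertices of the 5-cycle,
one for each choice of the first two up to symmetry. -/
def cycleOrders : List (Fin 5 × List (Fin 5)) :=
  [(0, [1, 2, 3, 4]), (0, [2, 1, 3, 4])]

/-- Orders of the vertices of the complete graph,
one for each choice of the first two up to symmetry. -/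
def completeOrders : List (Fin 4 × List (Fin 4)) :=
  [(0, [1, 2, 3])]

/-- The rooted patterns of a graph for the given orders of its vertices. -/
def rootedPatterns {n : ℕ} (l : Fin n → List (Fin n)) (os : List (Fin n × List (Fin n))) :
    List (List (Bool × List Bool)) :=
  os.map fun o => listPattern l o.1 o.2

/-- Patterns of the listed graphs other than the complete graph, in the gem-free case. -/
def gemTargets : List (List (Bool × List Bool)) :=
  -- The root `0` only affects the recorded masks, which `containsSome` ignores; the order therefore
  -- lists all vertices.
  [listPattern spindleAdj 0 [1, 2, 6, 3, 0, 5, 4],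
   listPattern tenAdj 0 [6, 7, 8, 9, 1, 4, 0, 5, 2, 3]]

/-- Patterns of the listed graphs other than the complete graph, in the second case. -/
def coP3P2Targets : List (List (Bool × List Bool)) :=
  [listPattern wheelAdj 0 [5, 0, 1, 2, 3, 4], listPattern spindleAdj 0 [1, 2, 6, 3, 0, 5, 4],
   listPattern crossedAdj 0 [0, 1, 5, 6, 2, 4, 3], listPattern denseAdj 0 [0, 1, 5, 6, 2, 4, 3],
   listPattern fannedAdj 0 [0, 1, 5, 6, 2, 4, 3]]

/-- The rooted patterns that are forbidden in the gem-free case. -/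
def gemForbidden : List (List (Bool × List Bool)) :=
  rootedPatterns pathAdj pathOrders ++ rootedPatterns gemAdj gemOrders ++
    rootedPatterns completeAdj completeOrders

/-- The rooted patterns that are forbidden in the second case. -/
def coP3P2Forbidden : List (List (Bool × List Bool)) :=
  rootedPatterns pathAdj pathOrders ++ rootedPatterns coP3P2Adj coP3P2Orders ++
    rootedPatterns completeAdj completeOrders

/-- The traces on a graph with `n` vertices that avoid the rooted patterns. -/
def allTraces (F : List (List (Bool × List Bool))) (n : ℕ) (h : List (ℕ × ℕ)) : List ℕ :=
  traces (constraints F h (fullMask n) (fullMask n)) (List.range (Nat.pow 2 n))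
end

/-! ### Masks -/

section Masks

variable {V : Type*}

theorem beq_eq_decide (a b : ℕ) : Nat.beq a b = decide (a = b) := by
  rw [Bool.eq_iff_iff, decide_eq_true_iff]
  exact ⟨Nat.eq_of_beq_eq_true, fun h => h ▸ Nat.beq_refl a⟩

theorem bit_eq_testBit (t i : ℕ) : bit t i = t.testBit i := by
  have h : Nat.land (Nat.shiftRight t i) 1 = t / 2 ^ i % 2 := by
    rw [← Nat.shiftRight_eq_div_pow, ← Nat.and_one_is_mod]; rfl
  rw [bit, h, Nat.testBit_eq_decide_div_mod_eq, beq_eq_decide]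

theorem submask_iff {a b : ℕ} : submask a b = true ↔ ∀ i, a.testBit i = true → b.testBit i = true := by
  have h : submask a b = true ↔ a &&& b = a := by
    rw [submask, beq_eq_decide, decide_eq_true_iff]; rfl
  rw [h]
  constructor
  · intro h i hi
    have := congrArg (Nat.testBit · i) h
    simp only [Nat.testBit_and, hi, Bool.true_and] at this
    exact this
  · intro h
    apply Nat.eq_of_testBit_eq
    intro i
    rw [Nat.testBit_and]
    have := h i
    revert this
    cases a.testBit i <;> simp

theorem land_eq_zero_iff {a b : ℕ} :
    Nat.beq (Nat.land a b) 0 = true ↔ ∀ i, a.testBit i = true → b.testBit i = false := by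
  have h : Nat.beq (Nat.land a b) 0 = true ↔ a &&& b = 0 := by
    rw [beq_eq_decide, decide_eq_true_iff]; rfl
  rw [h]
  constructor
  · intro h i hi
    have := congrArg (Nat.testBit · i) h
    simpa [Nat.testBit_and, hi] using this
  · intro h
    apply Nat.eq_of_testBit_eq
    intro i
    rw [Nat.testBit_and, Nat.zero_testBit]
    have := h i
    revert this
    cases a.testBit i <;> simp

theorem testBit_mask (p : V → Bool) (vs : List V) (i : ℕ) :
    (mask p vs).testBit i = (vs[i]?).any p := by
  induction vs generalizing i with
  | nil => simp [mask]
  | cons v vs ih =>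
    cases i with
    | zero => simp [mask]
    | succ i => simp [mask, Nat.testBit_bit_succ, ih]

theorem testBit_mask_getElem (p : V → Bool) {vs : List V} {i : ℕ} (hi : i < vs.length) :
    (mask p vs).testBit i = p vs[i] := by
  simp [testBit_mask, hi]

theorem exists_of_testBit_mask {p : V → Bool} {vs : List V} {i : ℕ}
    (h : (mask p vs).testBit i = true) : ∃ hi : i < vs.length, p vs[i] = true := by
  rw [testBit_mask, Option.any_eq_true] at h
  obtain ⟨x, hx, hp⟩ := h
  obtain ⟨hi, rfl⟩ := List.getElem?_eq_some_iff.1 hx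
  exact ⟨hi, hp⟩

theorem mask_append_singleton (p : V → Bool) (vs : List V) (w : V) :
    mask p (vs ++ [w]) = mask p vs + bif p w then 2 ^ vs.length else 0 := by
  induction vs with
  | nil => cases h : p w <;> simp [mask, Nat.bit_val, h]
  | cons v vs ih =>
    cases h : p w <;> simp [mask, Nat.bit_val, ih, h, pow_succ]; ring

theorem mask_congr {p q : V → Bool} {vs : List V} (h : ∀ v ∈ vs, p v = q v) :
    mask p vs = mask q vs := by
  induction vs with
  | nil => rfl
  | cons v vs ih =>
    simp only [mask, h v List.mem_cons_self, ih fun x hx => h x (List.mem_cons_of_mem _ hx)]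

theorem mask_lt (p : V → Bool) (vs : List V) : mask p vs < 2 ^ vs.length := by
  induction vs with
  | nil => simp [mask]
  | cons v vs ih =>
    rw [mask, Nat.bit_val, List.length_cons, pow_succ]
    have := Bool.toNat_le (p v)
    omega

theorem mask_not (p : V → Bool) (vs : List V) :
    mask (fun v => !p v) vs = Nat.xor (mask p vs) (fullMask vs.length) := by
  change _ = mask p vs ^^^ (2 ^ vs.length - 1)
  apply Nat.eq_of_testBit_eq
  intro i
  rw [Nat.testBit_xor, Nat.testBit_two_pow_sub_one, testBit_mask, testBit_mask]
  by_cases hi : i < vs.length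
  · simp [hi]
  · simp [hi]

/-- The entries of `l` play no role: its length only says how many bits to read. -/
theorem popcount_mask {α : Type*} (p : V → Bool) (vs : List V) (l : List α)
    (hl : l.length = vs.length) : popcount l (mask p vs) = vs.countP p := by
  induction vs generalizing l with
  | nil => rw [List.length_eq_zero_iff.1 hl]; rfl
  | cons v vs ih =>
    obtain _ | ⟨a, l⟩ := l
    · simp at hl
    have h1 : Nat.mod (Nat.bit (p v) (mask p vs)) 2 = (p v).toNat := by
      change Nat.bit (p v) (mask p vs) % 2 = _
      rw [Nat.bit_val]
      have := Bool.toNat_le (p v)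
      omega
    have h2 : Nat.div (Nat.bit (p v) (mask p vs)) 2 = mask p vs := by
      change Nat.bit (p v) (mask p vs) / 2 = _
      rw [Nat.bit_val]
      have := Bool.toNat_le (p v)
      omega
    rw [mask, popcount, h1, h2, ih l (by simpa using hl), List.countP_cons, Nat.add_eq]
    cases p v <;> simp [add_comm]

end Masks

/-! ### Traces, and the code of a list extended by one vertex -/

section Code

variable {V : Type*} (G : SimpleGraph V) [DecidableRel G.Adj]

/-- The trace of a vertex on a list of vertices. -/
def trace (vs : List V) (x : V) : ℕ := mask (fun v => decide (G.Adj x v)) vs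

variable {G}

theorem testBit_trace {vs : List V} {x : V} {i : ℕ} (hi : i < vs.length) :
    (trace G vs x).testBit i = true ↔ G.Adj x vs[i] := by
  rw [trace, testBit_mask_getElem _ hi, decide_eq_true_iff]

theorem exists_of_testBit_trace {vs : List V} {x : V} {i : ℕ}
    (h : (trace G vs x).testBit i = true) : ∃ hi : i < vs.length, G.Adj x vs[i] := by
  obtain ⟨hi, h⟩ := exists_of_testBit_mask h
  exact ⟨hi, of_decide_eq_true h⟩

theorem trace_append_singleton (vs : List V) (w x : V) :
    trace G (vs ++ [w]) x = trace G vs x ∨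
      trace G (vs ++ [w]) x = Nat.add (trace G vs x) (Nat.pow 2 vs.length) := by
  rw [trace, mask_append_singleton]
  by_cases h : G.Adj x w
  · right; simp [h, trace]
  · left; simp [h, trace]

variable [DecidableEq V]

theorem row_fst (vs : List V) (x : V) : (row G vs x).1 = trace G vs x := rfl

theorem testBit_row_snd {vs : List V} {x : V} {i : ℕ} (hi : i < vs.length) :
    (row G vs x).2.testBit i = true ↔ x ≠ vs[i] ∧ ¬ G.Adj x vs[i] := by
  rw [row, testBit_mask_getElem _ hi, decide_eq_true_iff]

theorem length_code (vs : List V) : (code G vs).length = vs.length := by simp [code]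

/-- The trace is halved along the rows, so its lowest bit always concerns the current one. Since `w`
is not among them, a row not adjacent to `w` has it as a genuine non-neighbour. -/
theorem extendRows_map (vs us : List V) (w : V) (hw : w ∉ us) :
    extendRows (2 ^ vs.length) (us.map (row G vs)) (trace G us w) =
      us.map (row G (vs ++ [w])) := by
  induction us with
  | nil => rfl
  | cons u us ih =>
    have hu : u ≠ w := fun h => hw (by simp [h])
    have h1 : bit (trace G (u :: us) w) 0 = decide (G.Adj w u) := by
      rw [bit_eq_testBit, trace, testBit_mask_getElem _ (by simp)]; rfl
    have h2 : Nat.div (trace G (u :: us) w) 2 = trace G us w := by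
      change Nat.bit (decide (G.Adj w u)) (mask _ us) / 2 = _
      rw [Nat.bit_val]
      have := Bool.toNat_le (decide (G.Adj w u))
      rw [trace]
      omega
    rw [List.map_cons, List.map_cons, extendRows, h1, h2, ih fun h => hw (by simp [h])]
    by_cases h : G.Adj w u
    · simp [h, row, mask_append_singleton, h.symm]
    · have h' : ¬ G.Adj u w := fun h' => h h'.symm
      simp [h, h', hu, row, mask_append_singleton]

theorem code_append_singleton (vs : List V) (w : V) (hw : w ∉ vs) :
    code G (vs ++ [w]) = extend vs.length (code G vs) (trace G vs w) := by
  have h1 : mask (fun x => decide (w ≠ x ∧ ¬ G.Adj w x)) vs =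
      mask (fun x => !decide (G.Adj w x)) vs := by
    apply mask_congr
    intro v hv
    have : w ≠ v := fun h => hw (h ▸ hv)
    simp [this]
  rw [code, extend, List.map_append]
  congr 1
  · exact (extendRows_map vs vs w hw).symm
  · simp only [List.map_cons, List.map_nil, row, mask_append_singleton, h1, mask_not]
    simp [trace]

theorem mem_zipIdx_code {vs : List V} {q : (ℕ × ℕ) × ℕ} (h : q ∈ (code G vs).zipIdx) :
    ∃ hi : q.2 < vs.length, q.1 = row G vs vs[q.2] := by
  rw [List.mem_zipIdx_iff_getElem?, code, List.getElem?_map, Option.map_eq_some_iff] at h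
  obtain ⟨x, hx, hq⟩ := h
  obtain ⟨hi, rfl⟩ := List.getElem?_eq_some_iff.1 hx
  exact ⟨hi, hq.symm⟩

end Code

/-! ### Copies of patterns -/

theorem bindRows_cons (f : ℕ × ℕ → ℕ → List (ℕ × ℕ)) (r : ℕ × ℕ) (rs : List (ℕ × ℕ)) (c b : ℕ) :
    bindRows f (r :: rs) c b = bif Nat.beq c 0 then [] else
      bif Nat.beq (Nat.land c 1) 1 then f r b ++ bindRows f rs (Nat.div c 2) (Nat.mul 2 b)
      else bindRows f rs (Nat.div c 2) (Nat.mul 2 b) := rfl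

/-- The bit doubles with each row, so row `i` receives `b * 2 ^ i`. Stopping early at `c = 0` loses
nothing, as no selected row remains. -/
theorem mem_bindRows {f : ℕ × ℕ → ℕ → List (ℕ × ℕ)} {h : List (ℕ × ℕ)} {c b : ℕ} {q : ℕ × ℕ} :
    q ∈ bindRows f h c b ↔
      ∃ i, ∃ hi : i < h.length, c.testBit i = true ∧ q ∈ f h[i] (b * 2 ^ i) := by
  induction h generalizing c b with
  | nil => simp [bindRows]
  | cons r rs ih =>
    have hdiv : ∀ i, (Nat.div c 2).testBit i = c.testBit (i + 1) := fun i =>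
      (Nat.testBit_add_one c i).symm
    have hbit : Nat.beq (Nat.land c 1) 1 = c.testBit 0 := by
      rw [← bit_eq_testBit]; rfl
    have key : (∃ i, ∃ hi : i < (r :: rs).length,
          c.testBit i = true ∧ q ∈ f (r :: rs)[i] (b * 2 ^ i)) ↔
        (c.testBit 0 = true ∧ q ∈ f r b) ∨ q ∈ bindRows f rs (Nat.div c 2) (Nat.mul 2 b) := by
      rw [ih]
      constructor
      · rintro ⟨_ | i, hi, hc, hq⟩
        · left; exact ⟨hc, by simpa using hq⟩
        · right
          refine ⟨i, by simpa using hi, by rw [hdiv]; exact hc, ?_⟩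
          have : Nat.mul 2 b * 2 ^ i = b * 2 ^ (i + 1) := by
            rw [Nat.mul_eq, pow_succ]; ring
          rw [this]
          simpa using hq
      · rintro (⟨hc, hq⟩ | ⟨i, hi, hc, hq⟩)
        · exact ⟨0, by simp, hc, by simpa using hq⟩
        · refine ⟨i + 1, by simpa using hi, by rw [← hdiv]; exact hc, ?_⟩
          have : Nat.mul 2 b * 2 ^ i = b * 2 ^ (i + 1) := by
            rw [Nat.mul_eq, pow_succ]; ring
          rw [← this]
          simpa using hq
    rw [key, bindRows_cons, hbit]
    by_cases hc : c = 0
    · subst hc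
      have : q ∉ bindRows f rs (Nat.div 0 2) (Nat.mul 2 b) := by
        rw [ih]
        rintro ⟨i, _, h, _⟩
        rw [hdiv, Nat.zero_testBit] at h
        exact Bool.noConfusion h
      simp only [this, Nat.zero_testBit]
      simp
    · have : Nat.beq c 0 = false := by
        rw [beq_eq_decide]; simpa using hc
      rw [this]
      cases c.testBit 0 <;> simp

section Compatible

variable {V W : Type*} {G : SimpleGraph V} {P : SimpleGraph W}

/-- Pairs of vertices of a pattern and their images that are compatible with an embedding. -/
def Compatible (P : SimpleGraph W) (G : SimpleGraph V) (q q' : W × V) : Prop :=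
  q.2 ≠ q'.2 ∧ (G.Adj q.2 q'.2 ↔ P.Adj q.1 q'.1)

/-- Choose an image for each pattern vertex. Pairs with different first entries are distinct, hence
compatible, which gives both injectivity and preservation of adjacency. -/
theorem isIndContained_of_pairwise {z : List (W × V)} (hz : z.Pairwise (Compatible P G))
    (hW : ∀ p : W, p ∈ z.map Prod.fst) : P.IsIndContained G := by
  have : Std.Symm (Compatible P G) :=
    ⟨fun q q' h => ⟨h.1.symm, by rw [G.adj_comm, P.adj_comm]; exact h.2⟩⟩
  have hz' : ∀ q ∈ z, ∀ q' ∈ z, q ≠ q' → Compatible P G q q' := by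
    intro q hq q' hq' hne
    exact hz.forall hq hq' hne
  have : ∀ p : W, ∃ x : V, (p, x) ∈ z := by
    intro p
    obtain ⟨q, hq, rfl⟩ := List.mem_map.1 (hW p)
    exact ⟨q.2, hq⟩
  choose f hf using this
  have hf' : ∀ p p', p ≠ p' → Compatible P G (p, f p) (p', f p') := fun p p' h =>
    hz' _ (hf p) _ (hf p') fun h' => h (Prod.ext_iff.1 h').1
  refine ⟨⟨⟨f, fun p p' h => ?_⟩, fun {p p'} => ?_⟩⟩
  · by_contra hne
    exact (hf' p p' hne).1 h
  · by_cases h : p = p'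
    · subst h; simp
    · exact (hf' p p' h).2

end Compatible

section Copies

variable {V W : Type*} [DecidableEq V] {G : SimpleGraph V} [DecidableRel G.Adj]
  {P : SimpleGraph W} {adj : W → W → Bool}

/-- Each placed vertex cuts the mask down to its neighbours or its non-neighbours. Neither mask
contains the vertex itself, so the new image differs from the old ones. -/
theorem testBit_candidates {vs : List V} {i : ℕ} (hi : i < vs.length) (p : W)
    (z : List (W × V)) (c : ℕ) :
    (candidates ((z.map Prod.fst).map (adj p)) (z.map fun q => row G vs q.2) c).testBit i = true ↔
      c.testBit i = true ∧ ∀ q ∈ z, q.2 ≠ vs[i] ∧ (G.Adj q.2 vs[i] ↔ adj p q.1 = true) := by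
  induction z generalizing c with
  | nil => simp [candidates]
  | cons q z ih =>
    have h : candidates (((q :: z).map Prod.fst).map (adj p))
        ((q :: z).map fun q => row G vs q.2) c =
        candidates ((z.map Prod.fst).map (adj p)) (z.map fun q => row G vs q.2)
          (c &&& bif adj p q.1 then (row G vs q.2).1 else (row G vs q.2).2) := by
      change candidates ((z.map Prod.fst).map (adj p)) (z.map fun q => row G vs q.2)
        (Nat.land c (Bool.rec (row G vs q.2).2 (row G vs q.2).1 (adj p q.1))) = _
      cases adj p q.1 <;> rfl
    rw [h, ih, Nat.testBit_and, Bool.and_eq_true, List.forall_mem_cons, and_assoc]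
    refine and_congr_right fun _ => and_congr_left fun _ => ?_
    cases hp : adj p q.1
    · simp only [cond_false, testBit_row_snd hi]
      simp
    · simp only [cond_true, row_fst, testBit_trace hi]
      constructor
      · intro h
        exact ⟨h.ne, by simpa using h⟩
      · intro h
        exact h.2.2 trivial

theorem copies_cons (h : List (ℕ × ℕ)) (full : ℕ) (s : Bool × List Bool)
    (ss : List (Bool × List Bool)) (acc : List (ℕ × ℕ)) (c pos neg : ℕ) :
    copies h full (s :: ss) acc c pos neg = bindRows (fun r b =>
      bif s.1 then copies h full ss (r :: acc) full (Nat.lor pos b) neg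
      else copies h full ss (r :: acc) full pos (Nat.lor neg b)) h (candidates s.2 acc c) 1 := rfl

/-- The trace `t` contains `pos` and avoids `neg`. -/
def Agrees (t : ℕ) (q : ℕ × ℕ) : Prop :=
  (∀ i, q.1.testBit i = true → t.testBit i = true) ∧
    ∀ i, q.2.testBit i = true → t.testBit i = false

theorem Agrees.of_lor_left {t pos neg i : ℕ} (h : Agrees t (Nat.lor pos (1 * 2 ^ i), neg)) :
    Agrees t (pos, neg) ∧ t.testBit i = true := by
  have hl : ∀ j, (Nat.lor pos (1 * 2 ^ i)).testBit j = (pos.testBit j || (2 ^ i).testBit j) := by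
    intro j
    rw [one_mul]
    exact Nat.testBit_or pos (2 ^ i) j
  refine ⟨⟨fun j hj => h.1 j ?_, h.2⟩, h.1 i ?_⟩
  · rw [hl]; simp [show pos.testBit j = true from hj]
  · rw [hl]; simp [Nat.testBit_two_pow_self]

theorem Agrees.of_lor_right {t pos neg i : ℕ} (h : Agrees t (pos, Nat.lor neg (1 * 2 ^ i))) :
    Agrees t (pos, neg) ∧ t.testBit i = false := by
  have hl : ∀ j, (Nat.lor neg (1 * 2 ^ i)).testBit j = (neg.testBit j || (2 ^ i).testBit j) := by
    intro j
    rw [one_mul]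
    exact Nat.testBit_or neg (2 ^ i) j
  refine ⟨⟨h.1, fun j hj => h.2 j ?_⟩, h.2 i ?_⟩
  · rw [hl]; simp [show neg.testBit j = true from hj]
  · rw [hl]; simp [Nat.testBit_two_pow_self]

/-- Every recorded copy comes from a compatible list of pairs. -/
theorem exists_of_mem_copies (hadj : ∀ p q, adj p q = true ↔ P.Adj p q) (root : W) (full : ℕ)
    (vs : List V) {q : ℕ × ℕ} (ps : List W) (z : List (W × V)) (c pos neg : ℕ)
    (hz : z.Pairwise (Compatible P G)) (hv : ∀ y ∈ z, y.2 ∈ vs)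
    (ht : ∀ x, Agrees (trace G vs x) (pos, neg) → ∀ y ∈ z, (G.Adj x y.2 ↔ P.Adj root y.1))
    (hq : q ∈ copies (code G vs) full (pattern adj root ps (z.map Prod.fst))
      (z.map fun y => row G vs y.2) c pos neg) :
    ∃ z' : List (W × V), z'.Pairwise (Compatible P G) ∧ (∀ y ∈ z', y.2 ∈ vs) ∧
      (∀ x, Agrees (trace G vs x) q → ∀ y ∈ z', (G.Adj x y.2 ↔ P.Adj root y.1)) ∧
      ∀ p, p ∈ ps ∨ p ∈ z.map Prod.fst → p ∈ z'.map Prod.fst := by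
  induction ps generalizing z c pos neg with
  | nil =>
    have : q = (pos, neg) := by
      simpa [pattern, copies] using hq
    subst this
    exact ⟨z, hz, hv, ht, fun p hp => hp.resolve_left (by simp)⟩
  | cons p ps ih =>
    rw [pattern, copies_cons, mem_bindRows] at hq
    obtain ⟨i, hi, hc, hq⟩ := hq
    rw [length_code] at hi
    have hrow : (code G vs)[i]'(by rwa [length_code]) = row G vs vs[i] := by simp [code]
    rw [hrow] at hq
    rw [testBit_candidates hi] at hc
    have hz' : ((p, vs[i]) :: z).Pairwise (Compatible P G) := by
      rw [List.pairwise_cons]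
      refine ⟨fun y hy => ⟨(hc.2 y hy).1.symm, ?_⟩, hz⟩
      rw [G.adj_comm, ← hadj]
      exact (hc.2 y hy).2
    have hv' : ∀ y ∈ (p, vs[i]) :: z, y.2 ∈ vs := by
      rw [List.forall_mem_cons]
      exact ⟨List.getElem_mem hi, hv⟩
    have fin : ∀ {z' : List (W × V)}, (∀ r, r ∈ ps ∨ r ∈ ((p, vs[i]) :: z).map Prod.fst →
        r ∈ z'.map Prod.fst) → ∀ r, r ∈ p :: ps ∨ r ∈ z.map Prod.fst → r ∈ z'.map Prod.fst := by
      intro z' h r hr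
      apply h
      rw [List.map_cons, List.mem_cons]
      rw [List.mem_cons] at hr
      tauto
    cases hp : adj root p
    · rw [hp, cond_false] at hq
      -- The new bit in the mask records exactly the required non-adjacency of the root's image to
      -- the image of `p`.
      have ht' : ∀ x, Agrees (trace G vs x) (pos, Nat.lor neg (1 * 2 ^ i)) →
          ∀ y ∈ (p, vs[i]) :: z, (G.Adj x y.2 ↔ P.Adj root y.1) := by
        intro x hx
        obtain ⟨h1, h2⟩ := hx.of_lor_right
        rw [List.forall_mem_cons]
        refine ⟨?_, ht x h1⟩
        rw [← hadj, hp, ← testBit_trace hi, h2]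
      obtain ⟨z', h1, h2, h3, h4⟩ := ih ((p, vs[i]) :: z) _ _ _ hz' hv' ht' hq
      exact ⟨z', h1, h2, h3, fin h4⟩
    · rw [hp, cond_true] at hq
      have ht' : ∀ x, Agrees (trace G vs x) (Nat.lor pos (1 * 2 ^ i), neg) →
          ∀ y ∈ (p, vs[i]) :: z, (G.Adj x y.2 ↔ P.Adj root y.1) := by
        intro x hx
        obtain ⟨h1, h2⟩ := hx.of_lor_left
        rw [List.forall_mem_cons]
        refine ⟨?_, ht x h1⟩
        rw [← hadj, hp, ← testBit_trace hi, h2]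
      obtain ⟨z', h1, h2, h3, h4⟩ := ih ((p, vs[i]) :: z) _ _ _ hz' hv' ht' hq
      exact ⟨z', h1, h2, h3, fin h4⟩

theorem isIndContained_of_mem_copies (hadj : ∀ p q, adj p q = true ↔ P.Adj p q) {root : W}
    {ps : List W} (hps : ∀ p, p ∈ ps) {vs : List V} {full c : ℕ} {q : ℕ × ℕ}
    (hq : q ∈ copies (code G vs) full (pattern adj root ps []) [] c 0 0) :
    P.IsIndContained G := by
  obtain ⟨z, h1, -, -, h4⟩ := exists_of_mem_copies (z := []) hadj root full vs ps c 0 0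
    List.Pairwise.nil (by simp) (by simp) hq
  exact isIndContained_of_pairwise h1 fun p => h4 p (Or.inl (hps p))

theorem isIndContained_of_agrees (hadj : ∀ p q, adj p q = true ↔ P.Adj p q) {root : W}
    {ps : List W} (hps : ∀ p, p = root ∨ p ∈ ps) {vs : List V} {full c : ℕ} {q : ℕ × ℕ}
    (hq : q ∈ copies (code G vs) full (pattern adj root ps []) [] c 0 0) {x : V} (hx : x ∉ vs)
    (ha : Agrees (trace G vs x) q) : P.IsIndContained G := by
  obtain ⟨z, h1, h2, h3, h4⟩ := exists_of_mem_copies (z := []) hadj root full vs ps c 0 0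
    List.Pairwise.nil (by simp) (by simp) hq
  apply isIndContained_of_pairwise (z := (root, x) :: z)
  · rw [List.pairwise_cons]
    exact ⟨fun y hy => ⟨fun h => hx (by rw [show x = y.2 from h]; exact h2 y hy), h3 x ha y hy⟩, h1⟩
  · intro p
    rw [List.map_cons, List.mem_cons]
    exact (hps p).imp_right fun h => h4 p (Or.inl h)

/-- An induced copy inside the listed vertices is found. -/
theorem exists_mem_copies (hadj : ∀ p q, adj p q = true ↔ P.Adj p q) (φ : P ↪g G) (root : W)
    {vs : List V} (hvs : ∀ v, v ∈ vs) (ps acc : List W) (hnd : ps.Nodup)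
    (hd : ∀ p ∈ ps, p ∉ acc) (pos neg : ℕ) :
    ∃ q, q ∈ copies (code G vs) (fullMask vs.length) (pattern adj root ps acc)
      (acc.map fun p => row G vs (φ p)) (fullMask vs.length) pos neg := by
  induction ps generalizing acc pos neg with
  | nil => exact ⟨(pos, neg), by simp [pattern, copies]⟩
  | cons p ps ih =>
    rw [List.nodup_cons] at hnd
    obtain ⟨i, hi, hp⟩ := List.getElem_of_mem (hvs (φ p))
    have hd' : ∀ r ∈ ps, r ∉ p :: acc := by
      intro r hr
      rw [List.mem_cons, not_or]
      exact ⟨fun h => hnd.1 (h ▸ hr), hd r (List.mem_cons_of_mem _ hr)⟩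
    have hcand : (candidates (acc.map (adj p)) (acc.map fun p => row G vs (φ p))
        (fullMask vs.length)).testBit i = true := by
      have := (testBit_candidates (G := G) (adj := adj) hi p (acc.map fun r => (r, φ r))
        (fullMask vs.length)).2 ⟨?_, ?_⟩
      · simpa [List.map_map, Function.comp_def] using this
      · change (2 ^ vs.length - 1).testBit i = true
        simp [Nat.testBit_two_pow_sub_one, hi]
      · intro q hq
        obtain ⟨r, hr, rfl⟩ := List.mem_map.1 hq
        rw [hp, hadj, P.adj_comm]
        refine ⟨fun h => hd p List.mem_cons_self ?_, φ.map_rel_iff⟩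
        rwa [← φ.injective h]
    obtain ⟨q, hq⟩ := ih (p :: acc) hnd.2 hd' (if adj root p then Nat.lor pos (1 * 2 ^ i) else pos)
      (if adj root p then neg else Nat.lor neg (1 * 2 ^ i))
    refine ⟨q, ?_⟩
    rw [pattern, copies_cons, mem_bindRows]
    refine ⟨i, by rwa [length_code], hcand, ?_⟩
    have hrow : (code G vs)[i]'(by rwa [length_code]) = row G vs (φ p) := by simp [code, hp]
    rw [hrow]
    cases h : adj root p <;> simpa [h] using hq

end Copies

/-! ### Three-colourings -/

section Coloring

variable {V : Type*} [DecidableEq V] {G : SimpleGraph V} [DecidableRel G.Adj]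

/-- Indexing the colour classes by `Fin 3` merges the three branches into one existential. -/
theorem colorable_cons (r : ℕ × ℕ) (rs : List (ℕ × ℕ)) (b : ℕ) (m : Fin 3 → ℕ) :
    colorable (r :: rs) b (m 0) (m 1) (m 2) = true ↔
      ∃ k : Fin 3, Nat.beq (Nat.land r.1 (m k)) 0 = true ∧
        colorable rs (2 * b) (m 0 + bif decide (k = 0) then b else 0)
          (m 1 + bif decide (k = 1) then b else 0) (m 2 + bif decide (k = 2) then b else 0) =
          true := by
  rw [colorable]
  simp [Fin.exists_fin_succ, or_assoc]

/-- Invariant of the backtracking: the vertices `ds` are already coloured by `c₀`, their colour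
classes are the three masks, and the question is whether the colouring extends to `us`. -/
theorem colorable_map_iff (vs us ds : List V) (hvs : vs = ds ++ us) (hnd : vs.Nodup)
    (c₀ : V → Fin 3) :
    colorable (us.map (row G vs)) (2 ^ ds.length) (mask (fun v => decide (c₀ v = 0)) ds)
        (mask (fun v => decide (c₀ v = 1)) ds) (mask (fun v => decide (c₀ v = 2)) ds) = true ↔
      ∃ c : V → Fin 3, (∀ d ∈ ds, c d = c₀ d) ∧ ∀ u ∈ us, ∀ v ∈ vs, G.Adj u v → c u ≠ c v := by
  induction us generalizing ds c₀ with
  | nil => simpa [colorable] using ⟨c₀, fun _ _ => rfl⟩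
  | cons u us ih =>
    have hu : u ∉ ds := by
      rw [hvs, List.nodup_append] at hnd
      exact fun h => hnd.2.2 u h u List.mem_cons_self rfl
    have hstep : ∀ k : Fin 3, Nat.beq (Nat.land (row G vs u).1
        (mask (fun v => decide (c₀ v = k)) ds)) 0 = true ↔ ∀ d ∈ ds, G.Adj u d → c₀ d ≠ k := by
      intro k
      rw [land_eq_zero_iff]
      constructor
      · intro h d hd hadj hk
        obtain ⟨i, hi, rfl⟩ := List.getElem_of_mem hd
        have hi' : i < vs.length := by rw [hvs, List.length_append]; omega
        have hget : vs[i] = ds[i] := by simp [hvs, hi]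
        have h1 : (row G vs u).1.testBit i = true := by
          rw [row_fst, testBit_trace hi', hget]; exact hadj
        have h2 := h i h1
        rw [testBit_mask_getElem _ hi] at h2
        simp [hk] at h2
      · intro h i hi
        by_contra hne
        rw [Bool.not_eq_false] at hne
        obtain ⟨hd, hk⟩ := exists_of_testBit_mask hne
        rw [row_fst] at hi
        obtain ⟨hv, ha⟩ := exists_of_testBit_trace hi
        have hget : vs[i] = ds[i] := by simp [hvs, hd]
        rw [hget] at ha
        exact h _ (List.getElem_mem hd) ha (of_decide_eq_true hk)
    have hrec : ∀ k : Fin 3, colorable (us.map (row G vs)) (2 * 2 ^ ds.length)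
        (mask (fun v => decide (c₀ v = 0)) ds + bif decide (k = 0) then 2 ^ ds.length else 0)
        (mask (fun v => decide (c₀ v = 1)) ds + bif decide (k = 1) then 2 ^ ds.length else 0)
        (mask (fun v => decide (c₀ v = 2)) ds + bif decide (k = 2) then 2 ^ ds.length else 0) =
          true ↔
        ∃ c : V → Fin 3, ((∀ d ∈ ds, c d = c₀ d) ∧ c u = k) ∧
          ∀ u ∈ us, ∀ v ∈ vs, G.Adj u v → c u ≠ c v := by
      intro k
      have hm : ∀ j : Fin 3, mask (fun v => decide (Function.update c₀ u k v = j)) (ds ++ [u]) =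
          mask (fun v => decide (c₀ v = j)) ds + bif decide (k = j) then 2 ^ ds.length else 0 := by
        intro j
        rw [mask_append_singleton]
        congr 1
        · apply mask_congr
          intro v hv
          rw [Function.update_of_ne (show v ≠ u from fun h => hu (h ▸ hv))]
        · simp
      -- Giving `u` the colour `k` is an update of `c₀`, harmless on `ds` because `u` is not in it.
      have := ih (ds ++ [u]) (by simp [hvs]) (Function.update c₀ u k)
      rw [hm, hm, hm, List.length_append, List.length_singleton, pow_succ, mul_comm] at this
      rw [this]
      refine exists_congr fun c => and_congr_left fun _ => ?_
      rw [List.forall_mem_append]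
      refine and_congr (forall₂_congr fun d hd => ?_) ?_
      · rw [Function.update_of_ne (show d ≠ u from fun h => hu (h ▸ hd))]
      · simp
    rw [List.map_cons, colorable_cons _ _ _ fun k => mask (fun v => decide (c₀ v = k)) ds]
    simp only [hstep, hrec]
    constructor
    · rintro ⟨k, hk, c, ⟨hc, hcu⟩, hus⟩
      refine ⟨c, hc, ?_⟩
      rw [List.forall_mem_cons]
      refine ⟨fun v hv hadj => ?_, hus⟩
      rw [hvs, List.mem_append, List.mem_cons] at hv
      obtain hv | rfl | hv := hv
      · rw [hcu, hc v hv]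
        exact (hk v hv hadj).symm
      · exact absurd hadj (G.irrefl)
      · exact (hus v hv u (by simp [hvs]) hadj.symm).symm
    · rintro ⟨c, hc, hus⟩
      rw [List.forall_mem_cons] at hus
      refine ⟨c u, fun d hd hadj => ?_, c, ⟨hc, rfl⟩, hus.2⟩
      rw [← hc d hd]
      exact (hus.1 d (by simp [hvs, hd]) hadj).symm

theorem colorable_code_iff {vs : List V} (hnd : vs.Nodup) :
    colorable (code G vs) 1 0 0 0 = true ↔
      ∃ c : V → Fin 3, ∀ u ∈ vs, ∀ v ∈ vs, G.Adj u v → c u ≠ c v := by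
  have := colorable_map_iff (G := G) vs vs [] rfl hnd fun _ => 0
  simpa [mask, code] using this

end Coloring

/-! ### Critical graphs -/

section Critical

variable {V : Type*} {G : SimpleGraph V}

/-- `G` has no colouring with three colours, but `G - v` has one for every vertex `v`. -/
structure IsCritical (G : SimpleGraph V) : Prop where
  not_colorable : ¬ ∃ c : V → Fin 3, ∀ x y, G.Adj x y → c x ≠ c y
  exists_coloring : ∀ v, ∃ c : V → Fin 3, ∀ x y, x ≠ v → y ≠ v → G.Adj x y → c x ≠ c y

theorem colorable_three_iff :
    G.Colorable 3 ↔ ∃ c : V → Fin 3, ∀ x y, G.Adj x y → c x ≠ c y := by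
  constructor
  · rintro ⟨c⟩
    exact ⟨c, fun x y h => c.valid h⟩
  · rintro ⟨c, hc⟩
    exact ⟨SimpleGraph.Coloring.mk c fun {x y} h => hc x y h⟩

theorem colorable_induce_compl_iff (v : V) :
    (G.induce ({v}ᶜ : Set V)).Colorable 3 ↔
      ∃ c : V → Fin 3, ∀ x y, x ≠ v → y ≠ v → G.Adj x y → c x ≠ c y := by
  classical
  constructor
  · rintro ⟨c⟩
    -- The value `0` at `v` is arbitrary: edges at `v` are not tested.
    refine ⟨fun x => if h : x ≠ v then c ⟨x, h⟩ else 0, fun x y hx hy h => ?_⟩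
    simp only [dif_pos hx, dif_pos hy]
    exact c.valid h
  · rintro ⟨c, hc⟩
    exact ⟨SimpleGraph.Coloring.mk (fun x => c x) fun {x y} h => hc x y x.2 y.2 h⟩

theorem isVertexCritical_four_iff : IsVertexCritical G 4 ↔ IsCritical G := by
  have hlt : ∀ {W : Type _} (H : SimpleGraph W), H.chromaticNumber < (4 : ℕ) ↔ H.Colorable 3 := by
    intro W H
    rw [← SimpleGraph.chromaticNumber_le_iff_colorable]
    have : ((4 : ℕ) : ℕ∞) = (3 : ℕ) + 1 := by norm_num
    rw [this, ENat.lt_add_one_iff (by simp)]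
  constructor
  · rintro ⟨h1, h2⟩
    refine ⟨fun h => ?_, fun v => ?_⟩
    · rw [← colorable_three_iff, ← hlt, h1] at h
      exact lt_irrefl _ h
    · rw [← colorable_induce_compl_iff, ← hlt]
      exact h2 v
  · rintro ⟨h1, h2⟩
    refine ⟨le_antisymm ?_ ?_, fun v => ?_⟩
    · rw [SimpleGraph.chromaticNumber_le_iff_colorable]
      have hne : Nonempty V := by
        by_contra h
        rw [not_nonempty_iff] at h
        exact h1 ⟨fun _ => 0, fun x => h.elim x⟩
      obtain ⟨v⟩ := hne
      obtain ⟨c, hc⟩ := h2 v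
      classical
      -- A 3-colouring of `G - v` extends by a fourth colour at `v`.
      refine ⟨SimpleGraph.Coloring.mk
        (fun x => if x = v then Fin.last 3 else (c x).castSucc) fun {x y} h => ?_⟩
      by_cases hx : x = v
      · by_cases hy : y = v
        · exact absurd (hx.trans hy.symm) h.ne
        · simpa [hx, hy] using (Fin.castSucc_lt_last (c y)).ne'
      · by_cases hy : y = v
        · simpa [hx, hy] using (Fin.castSucc_lt_last (c x)).ne
        · simpa [hx, hy] using hc x y hx hy h
    · rw [← not_lt, hlt, colorable_three_iff]
      exact h1
    · rw [hlt, colorable_induce_compl_iff]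
      exact h2 v

/-- A critical graph cannot be folded: there is no homomorphism from a nonempty part into the
rest that is compatible with the edges to the rest. -/
theorem IsCritical.not_foldable (hG : IsCritical G) (A : Set V) (hA : A.Nonempty) (φ : V → V)
    (hφ : ∀ a ∈ A, φ a ∉ A) (h1 : ∀ a ∈ A, ∀ x ∉ A, G.Adj a x → G.Adj (φ a) x)
    (h2 : ∀ a ∈ A, ∀ b ∈ A, G.Adj a b → G.Adj (φ a) (φ b)) : False := by
  classical
  obtain ⟨v, hv⟩ := hA
  obtain ⟨c, hc⟩ := hG.exists_coloring v
  have hne : ∀ x ∉ A, x ≠ v := fun x hx h => hx (h ▸ hv)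
  -- Each vertex of `A` copies the colour of its image. The images avoid `A`, hence the deleted
  -- vertex `v`, so only colours known to be proper are used.
  refine hG.not_colorable ⟨fun x => if x ∈ A then c (φ x) else c x, fun x y h => ?_⟩
  by_cases hx : x ∈ A <;> by_cases hy : y ∈ A <;> simp only [hx, hy, if_true, if_false]
  · exact hc _ _ (hne _ (hφ x hx)) (hne _ (hφ y hy)) (h2 x hx y hy h)
  · exact hc _ _ (hne _ (hφ x hx)) (hne _ hy) (h1 x hx y hy h)
  · exact (hc _ _ (hne _ (hφ y hy)) (hne _ hx) (h1 y hy x hx h.symm)).symm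
  · exact hc _ _ (hne _ hx) (hne _ hy) h

/-- No neighbourhood is contained in another one. -/
theorem IsCritical.exists_adj_not_adj (hG : IsCritical G) {u v : V} (huv : u ≠ v) :
    ∃ x, G.Adj x u ∧ ¬ G.Adj x v := by
  by_contra! h
  refine hG.not_foldable {u} ⟨u, rfl⟩ (fun _ => v) (fun a _ => huv.symm) ?_ ?_
  · rintro a rfl x - hx
    exact (h x hx.symm).symm
  · rintro a rfl b rfl hx
    exact absurd hx G.irrefl

/-- An edge `ab` cannot be folded on a disjoint edge `cd`. -/
theorem IsCritical.exists_adj_of_edges (hG : IsCritical G) {a b c d : V} (hab : G.Adj a b)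
    (hcd : G.Adj c d) (hca : a ≠ c) (hcb : b ≠ c) (hda : a ≠ d) (hdb : b ≠ d) :
    ∃ x, (x ≠ b ∧ G.Adj x a ∧ ¬ G.Adj x c) ∨ (x ≠ a ∧ G.Adj x b ∧ ¬ G.Adj x d) := by
  classical
  by_contra! h
  refine hG.not_foldable {a, b} ⟨a, by simp⟩ (fun x => if x = a then c else d) ?_ ?_ ?_
  · rintro x (rfl | rfl)
    · simp [hca.symm, hcb.symm]
    · simp [hab.ne', hda.symm, hdb.symm]
  · rintro x (rfl | rfl) y hy hxy
    · rw [Set.mem_insert_iff, Set.mem_singleton_iff, not_or] at hy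
      simpa using ((h y).1 hy.2 hxy.symm).symm
    · rw [Set.mem_insert_iff, Set.mem_singleton_iff, not_or] at hy
      simpa [hab.ne'] using ((h y).2 hy.1 hxy.symm).symm
  · rintro x (rfl | rfl) y (rfl | rfl) hxy
    · exact absurd hxy G.irrefl
    · simpa [hab.ne'] using hcd
    · simpa [hab.ne'] using hcd.symm
    · exact absurd hxy G.irrefl

/-- All degrees are at least three. -/
theorem IsCritical.exists_adj_not_mem (hG : IsCritical G) (u : V) {l : List V}
    (hl : l.length ≤ 2) : ∃ x, G.Adj x u ∧ x ∉ l := by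
  classical
  by_contra! h
  obtain ⟨c, hc⟩ := hG.exists_coloring u
  -- At most two colours occur around `u`, so a colouring of `G - u` leaves a third one free for
  -- `u`.
  obtain ⟨k, hk⟩ : ∃ k : Fin 3, k ∉ l.map c := by
    by_contra! hk
    have h1 : (Finset.univ : Finset (Fin 3)) ⊆ (l.map c).toFinset := fun k _ => by
      rw [List.mem_toFinset]; exact hk k
    have h2 := Finset.card_le_card h1
    have h3 := List.toFinset_card_le (l.map c)
    rw [Finset.card_univ, Fintype.card_fin] at h2
    rw [List.length_map] at h3
    omega
  have hk' : ∀ x, G.Adj x u → c x ≠ k := fun x hx h' => hk (List.mem_map.2 ⟨x, h x hx, h'⟩)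
  refine hG.not_colorable ⟨fun x => if x = u then k else c x, fun x y hxy => ?_⟩
  by_cases hx : x = u <;> by_cases hy : y = u
  · exact absurd (hx.trans hy.symm) hxy.ne
  · simpa [hx, hy] using (hk' y (hx ▸ hxy.symm)).symm
  · simpa [hx, hy] using hk' x (hy ▸ hxy)
  · simpa [hx, hy] using hc x y hx hy hxy

/-- A nonempty three-colourable part has a neighbour outside. -/
theorem IsCritical.exists_adj_outside (hG : IsCritical G) {A : Set V} (hA : A.Nonempty)
    (hcol : ∃ c : V → Fin 3, ∀ x ∈ A, ∀ y ∈ A, G.Adj x y → c x ≠ c y) :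
    ∃ x ∉ A, ∃ y ∈ A, G.Adj x y := by
  classical
  by_contra! h
  obtain ⟨v, hv⟩ := hA
  obtain ⟨c, hc⟩ := hG.exists_coloring v
  obtain ⟨c', hc'⟩ := hcol
  -- With no edges between `A` and the rest, the two colourings can be glued.
  refine hG.not_colorable ⟨fun x => if x ∈ A then c' x else c x, fun x y hxy => ?_⟩
  by_cases hx : x ∈ A <;> by_cases hy : y ∈ A
  · simpa [hx, hy] using hc' x hx y hy hxy
  · exact absurd hxy.symm (h y hy x hx)
  · exact absurd hxy (h x hx y hy)
  · simpa [hx, hy] using hc x y (fun h => hx (h ▸ hv)) (fun h => hy (h ▸ hv)) hxy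

/-- A critical graph that contains a graph without a three-colouring is equal to it. -/
theorem IsCritical.nonempty_iso {W : Type*} {H : SimpleGraph W} (hG : IsCritical G)
    (hH : ¬ ∃ c : W → Fin 3, ∀ x y, H.Adj x y → c x ≠ c y) (h : H.IsIndContained G) :
    Nonempty (G ≃g H) := by
  obtain ⟨φ⟩ := h
  -- If a vertex `v` were missed, a 3-colouring of `G - v` would restrict to `H`.
  have hsurj : Function.Surjective φ := by
    by_contra hs
    rw [Function.Surjective] at hs
    push Not at hs
    obtain ⟨v, hv⟩ := hs
    obtain ⟨c, hc⟩ := hG.exists_coloring v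
    exact hH ⟨c ∘ φ, fun x y hxy => hc _ _ (hv x) (hv y) (φ.map_rel_iff.2 hxy)⟩
  let e : H ≃g G := ⟨Equiv.ofBijective φ ⟨φ.injective, hsurj⟩, φ.map_rel_iff⟩
  exact ⟨e.symm⟩

end Critical

/-! ### Soundness of the search -/

section Obstructions

variable {V : Type*} {G : SimpleGraph V} [DecidableRel G.Adj] {vs : List V} {L o : List ℕ}

theorem submask_trace {x y : V} (h : submask (trace G vs x) (trace G vs y) = true) {z : V}
    (hz : z ∈ vs) (hx : G.Adj z x) : G.Adj z y := by
  obtain ⟨i, hi, rfl⟩ := List.getElem_of_mem hz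
  exact ((testBit_trace hi).1 (submask_iff.1 h i ((testBit_trace hi).2 hx.symm))).symm

theorem submask_trace_lor {x y : V} {j : ℕ} (hj : j < vs.length)
    (h : submask (trace G vs x) (Nat.lor (trace G vs y) (Nat.pow 2 j)) = true) {z : V}
    (hz : z ∈ vs) (hzj : z ≠ vs[j]) (hx : G.Adj z x) : G.Adj z y := by
  obtain ⟨i, hi, rfl⟩ := List.getElem_of_mem hz
  have h1 := submask_iff.1 h i ((testBit_trace hi).2 hx.symm)
  have h2 : (Nat.lor (trace G vs y) (Nat.pow 2 j)).testBit i =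
      ((trace G vs y).testBit i || (2 ^ j).testBit i) := Nat.testBit_or _ _ i
  have h3 : j ≠ i := fun h => hzj (by simp [h])
  rw [h2, Nat.testBit_two_pow_of_ne h3, Bool.or_false, testBit_trace hi] at h1
  exact h1.symm

theorem ne_of_index_ne (hnd : vs.Nodup) {i j : ℕ} (hi : i < vs.length) (hj : j < vs.length)
    (h : Nat.beq i j = false) : vs[i] ≠ vs[j] := by
  rw [beq_eq_decide, decide_eq_false_iff_not] at h
  rwa [Ne, hnd.getElem_inj_iff]

theorem bit_trace {x : V} {i : ℕ} (hi : i < vs.length) :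
    bit (trace G vs x) i = true ↔ G.Adj x vs[i] := by
  rw [bit_eq_testBit, testBit_trace hi]

theorem bit_trace_eq_false {x : V} {i : ℕ} (hi : i < vs.length) :
    bit (trace G vs x) i = false ↔ ¬ G.Adj x vs[i] := by
  rw [← bit_trace hi, Bool.not_eq_true]

variable [DecidableEq V]

/-- Criticality supplies a vertex adjacent to `u` but not to `v`. The inclusion of neighbourhoods
inside `vs` keeps it out of `vs`, so its trace is among those selected. The next three lemmas follow
the same scheme. -/
theorem exists_trace_mem_domObs (hG : IsCritical G) (hnd : vs.Nodup)
    (hL : ∀ x ∉ vs, trace G vs x ∈ L) (ho : o ∈ domObs (code G vs).zipIdx L) :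
    ∃ x ∉ vs, trace G vs x ∈ o := by
  simp only [domObs, List.mem_flatMap] at ho
  obtain ⟨u, hu, v, hv, ho⟩ := ho
  obtain ⟨hu, hu'⟩ := mem_zipIdx_code hu
  obtain ⟨hv, hv'⟩ := mem_zipIdx_code hv
  rw [hu', hv', row_fst, row_fst] at ho
  cases hc : submask (trace G vs vs[u.2]) (trace G vs vs[v.2]) && !Nat.beq u.2 v.2
  · simp [hc] at ho
  rw [hc, cond_true, List.mem_singleton] at ho
  rw [Bool.and_eq_true, Bool.not_eq_true'] at hc
  obtain ⟨x, hx1, hx2⟩ := hG.exists_adj_not_adj (ne_of_index_ne hnd hu hv hc.2)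
  have hx : x ∉ vs := fun h => hx2 (submask_trace hc.1 h hx1)
  refine ⟨x, hx, ?_⟩
  rw [ho, List.mem_filter, Bool.and_eq_true, Bool.not_eq_true', bit_trace hu,
    bit_trace_eq_false hv]
  exact ⟨hL x hx, hx1, hx2⟩

theorem exists_trace_mem_degObs (hG : IsCritical G)
    (hL : ∀ x ∉ vs, trace G vs x ∈ L) (ho : o ∈ degObs (code G vs).zipIdx L) :
    ∃ x ∉ vs, trace G vs x ∈ o := by
  simp only [degObs, List.mem_flatMap] at ho
  obtain ⟨u, hu, ho⟩ := ho
  obtain ⟨hu, hu'⟩ := mem_zipIdx_code hu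
  rw [hu', row_fst, trace, popcount_mask _ _ _ (by simp [length_code])] at ho
  cases hc : Nat.ble (vs.countP fun v => decide (G.Adj vs[u.2] v)) 2
  · simp [hc] at ho
  rw [hc, cond_true, List.mem_singleton] at ho
  have hle := Nat.le_of_ble_eq_true hc
  rw [List.countP_eq_length_filter] at hle
  obtain ⟨x, hx1, hx2⟩ := hG.exists_adj_not_mem vs[u.2] hle
  have hx : x ∉ vs := fun h => hx2 (List.mem_filter.2 ⟨h, decide_eq_true hx1.symm⟩)
  refine ⟨x, hx, ?_⟩
  rw [ho, List.mem_filter, bit_trace hu]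
  exact ⟨hL x hx, hx1⟩

theorem exists_trace_mem_homObs (hG : IsCritical G) (hnd : vs.Nodup)
    (hL : ∀ x ∉ vs, trace G vs x ∈ L) (ho : o ∈ homObs (code G vs).zipIdx L) :
    ∃ x ∉ vs, trace G vs x ∈ o := by
  simp only [homObs, List.mem_flatMap] at ho
  obtain ⟨a, ha, b, hb, ho⟩ := ho
  obtain ⟨ha, ha'⟩ := mem_zipIdx_code ha
  obtain ⟨hb, hb'⟩ := mem_zipIdx_code hb
  rw [ha', hb', row_fst, row_fst] at ho
  cases h1 : bit (trace G vs vs[a.2]) b.2 && Nat.blt a.2 b.2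
  · simp [h1] at ho
  rw [h1, cond_true, List.mem_flatMap] at ho
  obtain ⟨c, hc, ho⟩ := ho
  obtain ⟨hc, hc'⟩ := mem_zipIdx_code hc
  rw [hc', row_fst] at ho
  cases h2 : submask (trace G vs vs[a.2]) (Nat.lor (trace G vs vs[c.2]) (Nat.pow 2 b.2)) &&
    !Nat.beq a.2 c.2 && !Nat.beq b.2 c.2
  · rw [h2, cond_false] at ho
    exact absurd ho List.not_mem_nil
  rw [h2, cond_true, List.mem_flatMap] at ho
  obtain ⟨d, hd, ho⟩ := ho
  obtain ⟨hd, hd'⟩ := mem_zipIdx_code hd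
  rw [hd', row_fst] at ho
  cases h3 : submask (trace G vs vs[b.2]) (Nat.lor (trace G vs vs[d.2]) (Nat.pow 2 a.2)) &&
    bit (trace G vs vs[c.2]) d.2 && !Nat.beq a.2 d.2 && !Nat.beq b.2 d.2
  · rw [h3, cond_false] at ho
    exact absurd ho List.not_mem_nil
  rw [h3, cond_true, List.mem_singleton] at ho
  simp only [Bool.and_eq_true, Bool.not_eq_true'] at h1 h2 h3
  obtain ⟨x, hx⟩ := hG.exists_adj_of_edges ((bit_trace hb).1 h1.1) ((bit_trace hd).1 h3.1.1.2)
    (ne_of_index_ne hnd ha hc h2.1.2) (ne_of_index_ne hnd hb hc h2.2)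
    (ne_of_index_ne hnd ha hd h3.1.2) (ne_of_index_ne hnd hb hd h3.2)
  -- The inclusions tolerate the other end of the edge `ab`, which the conditions `x ≠ b` and `x ≠
  -- a` exclude.
  have hxv : x ∉ vs := by
    intro h
    obtain ⟨hx1, hx2, hx3⟩ | ⟨hx1, hx2, hx3⟩ := hx
    · exact hx3 (submask_trace_lor hb h2.1.1 h hx1 hx2)
    · exact hx3 (submask_trace_lor ha h3.1.1.1 h hx1 hx2)
  refine ⟨x, hxv, ?_⟩
  rw [ho, List.mem_filter, Bool.or_eq_true, Bool.and_eq_true, Bool.and_eq_true, Bool.not_eq_true',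
    Bool.not_eq_true', bit_trace ha, bit_trace hb, bit_trace_eq_false hc, bit_trace_eq_false hd]
  exact ⟨hL x hxv, hx.imp And.right And.right⟩

theorem exists_trace_mem_restObs (hG : IsCritical G) (hnd : vs.Nodup)
    (hL : ∀ x ∉ vs, trace G vs x ∈ L) (ho : o ∈ restObs (code G vs) L) :
    ∃ x ∉ vs, trace G vs x ∈ o := by
  rw [restObs] at ho
  cases hc : !(code G vs).isEmpty && colorable (code G vs) 1 0 0 0
  · simp [hc] at ho
  rw [hc, cond_true, List.mem_singleton] at ho
  rw [Bool.and_eq_true, colorable_code_iff hnd] at hc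
  have hne : {v | v ∈ vs}.Nonempty := by
    obtain _ | ⟨v, vs⟩ := vs
    · simp [code] at hc
    · exact ⟨v, List.mem_cons_self⟩
  obtain ⟨x, hx, y, hy, hxy⟩ := hG.exists_adj_outside hne hc.2
  refine ⟨x, hx, ?_⟩
  rw [ho, List.mem_filter, Bool.not_eq_true', beq_eq_decide, decide_eq_false_iff_not]
  refine ⟨hL x hx, fun h0 => ?_⟩
  obtain ⟨i, hi, rfl⟩ := List.getElem_of_mem hy
  have := (testBit_trace hi).2 hxy
  rw [h0, Nat.zero_testBit] at this
  exact Bool.noConfusion this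

theorem exists_trace_mem_allObs (hG : IsCritical G) (hnd : vs.Nodup)
    (hL : ∀ x ∉ vs, trace G vs x ∈ L) (ho : o ∈ allObs (code G vs) L) :
    ∃ x ∉ vs, trace G vs x ∈ o := by
  have main : o ∈ homObs (code G vs).zipIdx L ++ (domObs (code G vs).zipIdx L ++
      degObs (code G vs).zipIdx L ++ restObs (code G vs) L) := by
    simp only [allObs] at ho
    revert ho
    cases List.any _ _
    · exact id
    · exact List.mem_append_right _
  simp only [List.mem_append] at main
  obtain h | (h | h) | h := main
  · exact exists_trace_mem_homObs hG hnd hL h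
  · exact exists_trace_mem_domObs hG hnd hL h
  · exact exists_trace_mem_degObs hG hL h
  · exact exists_trace_mem_restObs hG hnd hL h

theorem shortest_mem (os : List (List ℕ)) (o : List ℕ) : shortest os o ∈ o :: os := by
  induction os generalizing o with
  | nil => simp [shortest]
  | cons o' os ih =>
    rw [shortest]
    cases Nat.blt o'.length o.length
    · have := ih o
      simp only [cond_false, List.mem_cons] at this ⊢
      tauto
    · have := ih o'
      simp only [cond_true, List.mem_cons] at this ⊢
      tauto

end Obstructions

/-! ### Rotations of an induced 5-cycle -/

section Cycle

instance {n : ℕ} (l : Fin n → List (Fin n)) : DecidableRel (ofAdjLists l).Adj := fun i j =>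
  inferInstanceAs (Decidable (i ≠ j ∧ (j ∈ l i ∨ i ∈ l j)))

variable {V : Type*} {G : SimpleGraph V}

/-- The rotation of the 5-cycle. -/
def rotation : ofAdjLists cycleAdj ≃g ofAdjLists cycleAdj where
  toEquiv := Equiv.addRight 1
  map_rel_iff' := by decide

/-- The vertices of a 5-cycle. -/
def cycleVertices (φ : ofAdjLists cycleAdj ↪g G) : List V := (List.finRange 5).map φ

theorem mem_cycleVertices_rotation (φ : ofAdjLists cycleAdj ↪g G) (x : V) :
    x ∈ cycleVertices (φ.comp rotation.toEmbedding) ↔ x ∈ cycleVertices φ := by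
  have h1 : cycleVertices φ = [φ 0, φ 1, φ 2, φ 3, φ 4] := rfl
  have h2 : cycleVertices (φ.comp rotation.toEmbedding) = [φ 1, φ 2, φ 3, φ 4, φ 0] := rfl
  rw [h1, h2]
  simp only [List.mem_cons, List.not_mem_nil]
  tauto

/-- Rotating the embedding moves the lowest of the five bits to the top; this is verified on all 32
traces. -/
theorem trace_rotation [DecidableRel G.Adj] (φ : ofAdjLists cycleAdj ↪g G) (x : V) :
    trace G (cycleVertices (φ.comp rotation.toEmbedding)) x =
      turn (trace G (cycleVertices φ) x) := by
  have h1 : cycleVertices φ = [φ 0, φ 1, φ 2, φ 3, φ 4] := rfl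
  have h2 : cycleVertices (φ.comp rotation.toEmbedding) = [φ 1, φ 2, φ 3, φ 4, φ 0] := rfl
  rw [h1, h2]
  simp only [trace, mask]
  generalize decide (G.Adj x (φ 0)) = a
  generalize decide (G.Adj x (φ 1)) = b
  generalize decide (G.Adj x (φ 2)) = c
  generalize decide (G.Adj x (φ 3)) = d
  generalize decide (G.Adj x (φ 4)) = e
  revert a b c d e
  decide

end Cycle

/-! ### Correctness of the branching -/

section Search

variable {V : Type*} [DecidableEq V] {G : SimpleGraph V} [DecidableRel G.Adj]
  {F T : List (List (Bool × List Bool))}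

/-- No vertex completes a copy of a pattern minus its root. -/
def AvoidsRooted (G : SimpleGraph V) [DecidableRel G.Adj] (P : List (Bool × List Bool)) : Prop :=
  ∀ (vs : List V) (x : V), x ∉ vs → ∀ full c : ℕ, ∀ q ∈ copies (code G vs) full P [] c 0 0,
    ¬ Agrees (trace G vs x) q

/-- There is no copy of a pattern. -/
def Avoids (G : SimpleGraph V) [DecidableRel G.Adj] (P : List (Bool × List Bool)) : Prop :=
  ∀ (vs : List V) (full c : ℕ), copies (code G vs) full P [] c 0 0 = []

/-- A trace is discarded only if it would complete a forbidden graph. This holds for any starting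
mask `c`, so looking only at copies through the newest vertex is sound. -/
theorem trace_mem_traces (hF : ∀ P ∈ F, AvoidsRooted G P) {vs : List V} {x : V} (hx : x ∉ vs)
    (full c : ℕ) {L : List ℕ} (hL : trace G vs x ∈ L) :
    trace G vs x ∈ traces (constraints F (code G vs) full c) L := by
  rw [traces, List.mem_filter, List.all_eq_true]
  refine ⟨hL, fun q hq => ?_⟩
  rw [constraints, List.mem_flatMap] at hq
  obtain ⟨P, hP, hq⟩ := hq
  rw [Bool.not_eq_true', ← Bool.not_eq_true, Bool.and_eq_true, submask_iff, land_eq_zero_iff]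
  rintro ⟨h1, h2⟩
  refine hF P hP vs x hx full c q hq ⟨h1, fun i hi => ?_⟩
  by_contra h
  rw [Bool.not_eq_false] at h
  rw [h2 i h] at hi
  exact Bool.noConfusion hi

theorem trace_mem_allTraces (hF : ∀ P ∈ F, AvoidsRooted G P) {vs : List V} {x : V} (hx : x ∉ vs) :
    trace G vs x ∈ allTraces F vs.length (code G vs) :=
  trace_mem_traces hF hx _ _ (List.mem_range.2 (mask_lt _ _))

theorem trace_mem_nextTraces (hF : ∀ P ∈ F, AvoidsRooted G P) {vs : List V} {w : V} (hw : w ∉ vs)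
    {L : List ℕ} (hL : ∀ x ∉ vs, trace G vs x ∈ L) {x : V} (hx : x ∉ vs ++ [w]) :
    trace G (vs ++ [w]) x ∈ nextTraces F vs.length (code G vs) (trace G vs w) L := by
  rw [nextTraces, ← code_append_singleton _ _ hw]
  refine trace_mem_traces hF hx _ _ (List.mem_flatMap.2 ⟨trace G vs x, hL x fun h => hx ?_, ?_⟩)
  · exact List.mem_append_left _ h
  · simpa using trace_append_singleton vs w x

theorem not_containsSome (hT : ∀ P ∈ T, Avoids G P) (vs : List V) (n : ℕ) :
    containsSome T n (code G vs) = false := by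
  rw [containsSome, List.any_eq_false]
  intro P hP
  simp [hT P hP vs]

/-- The invariant is `hL`: `L` contains the traces of all vertices outside `vs`. It survives both
branches, and it forbids an empty obstruction, so on a real critical graph the search cannot
succeed. -/
theorem search_sound (hG : IsCritical G) (hF : ∀ P ∈ F, AvoidsRooted G P)
    (hT : ∀ P ∈ T, Avoids G P) (k : ℕ) (vs : List V) (hnd : vs.Nodup) (L : List ℕ)
    (hL : ∀ x ∉ vs, trace G vs x ∈ L) :
    search F T k vs.length (code G vs) L = false := by
  induction k generalizing vs L with
  | zero => rfl
  | succ k ih =>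
    rw [search, not_containsSome hT, Bool.false_or]
    split
    · rfl
    · rename_i o os ho
      have hobs : ∃ x ∉ vs, trace G vs x ∈ shortest os o :=
        exists_trace_mem_allObs hG hnd hL (ho ▸ shortest_mem os o)
      split
      · rename_i h
        rw [h] at hobs
        simp at hobs
      · rename_i t ts h
        by_cases hex : ∃ x ∉ vs, trace G vs x = t
        · obtain ⟨w, hw, rfl⟩ := hex
          have := ih (vs ++ [w]) (by
              rw [List.nodup_append]
              exact ⟨hnd, by simp, fun a ha b hb => by
                rw [List.mem_singleton] at hb
                exact fun h => hw (hb ▸ h ▸ ha)⟩)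
            (nextTraces F vs.length (code G vs) (trace G vs w) L)
            fun x hx => trace_mem_nextTraces hF hw hL hx
          rw [List.length_append, List.length_singleton, code_append_singleton _ _ hw] at this
          rw [show Nat.succ vs.length = vs.length + 1 from rfl, this, Bool.false_and]
        · push Not at hex
          rw [ih vs hnd (L.erase t) fun x hx => (List.mem_erase_of_ne (hex x hx)).2 (hL x hx),
            Bool.and_false]

theorem code_map {W : Type*} [DecidableEq W] {P : SimpleGraph W} [DecidableRel P.Adj]
    (φ : P ↪g G) (ps : List W) : code G (ps.map φ) = code P ps := by
  have hm : ∀ (f : V → Bool) (l : List W), mask f (l.map φ) = mask (fun w => f (φ w)) l := by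
    intro f l
    induction l with
    | nil => rfl
    | cons a l ih => simp [mask, ih]
  rw [code, code, List.map_map]
  refine List.map_congr_left fun p _ => ?_
  simp [row, hm, φ.map_rel_iff]

theorem code_cycleVertices (φ : ofAdjLists cycleAdj ↪g G) :
    code G (cycleVertices φ) = cycleCode := by
  rw [cycleVertices, code_map]
  decide +kernel

/-- Here `hL` speaks of all induced 5-cycles at once. Hence either some 5-cycle realises `t`, and
the search continues there, or none does, and every trace with a rotation equal to `t` may go. -/
theorem cycleSearch_sound (hG : IsCritical G) (hF : ∀ P ∈ F, AvoidsRooted G P)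
    (hT : ∀ P ∈ T, Avoids G P) (φ₀ : ofAdjLists cycleAdj ↪g G) (k : ℕ) (L : List ℕ)
    (hL : ∀ φ : ofAdjLists cycleAdj ↪g G, ∀ x ∉ cycleVertices φ, trace G (cycleVertices φ) x ∈ L) :
    cycleSearch F T k L = false := by
  have hnd : ∀ φ : ofAdjLists cycleAdj ↪g G, (cycleVertices φ).Nodup := fun φ =>
    (List.nodup_finRange 5).map φ.injective
  have hlen : ∀ φ : ofAdjLists cycleAdj ↪g G, (cycleVertices φ).length = 5 := fun φ => rfl
  induction k generalizing L with
  | zero => rfl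
  | succ k ih =>
    rw [cycleSearch]
    split
    · rfl
    · rename_i o os ho
      have hobs : ∃ x ∉ cycleVertices φ₀, trace G (cycleVertices φ₀) x ∈ shortest os o :=
        exists_trace_mem_allObs hG (hnd φ₀) (hL φ₀)
          (by rw [code_cycleVertices, ho]; exact shortest_mem os o)
      split
      · rename_i h
        rw [h] at hobs
        simp at hobs
      · rename_i t ts h
        by_cases hex : ∃ φ : ofAdjLists cycleAdj ↪g G, ∃ x ∉ cycleVertices φ,
            trace G (cycleVertices φ) x = t
        · obtain ⟨φ, w, hw, rfl⟩ := hex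
          have := search_sound hG hF hT 100 (cycleVertices φ ++ [w]) (by
              rw [List.nodup_append]
              exact ⟨hnd φ, by simp, fun a ha b hb => by
                rw [List.mem_singleton] at hb
                exact fun h => hw (hb ▸ h ▸ ha)⟩)
            (nextTraces F 5 (code G (cycleVertices φ)) (trace G (cycleVertices φ) w) L)
            fun x hx => trace_mem_nextTraces hF hw (hL φ) hx
          rw [List.length_append, List.length_singleton, code_append_singleton _ _ hw, hlen,
            code_cycleVertices] at this
          rw [this, Bool.false_and]
        · push Not at hex
          rw [ih, Bool.and_false]
          intro φ x hx
          rw [List.mem_filter]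
          refine ⟨hL φ x hx, ?_⟩
          have hturn : ∀ φ : ofAdjLists cycleAdj ↪g G, ∀ s, x ∉ cycleVertices φ →
              trace G (cycleVertices φ) x = s →
              ∃ φ' : ofAdjLists cycleAdj ↪g G, x ∉ cycleVertices φ' ∧
                trace G (cycleVertices φ') x = turn s := fun φ s h1 h2 =>
            ⟨φ.comp rotation.toEmbedding, by rwa [mem_cycleVertices_rotation],
              by rw [trace_rotation, h2]⟩
          obtain ⟨φ1, h1, e1⟩ := hturn φ _ hx rfl
          obtain ⟨φ2, h2, e2⟩ := hturn φ1 _ h1 e1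
          obtain ⟨φ3, h3, e3⟩ := hturn φ2 _ h2 e2
          obtain ⟨φ4, h4, e4⟩ := hturn φ3 _ h3 e3
          -- The rotated traces of `x` are its traces on rotated embeddings, so none of them is `t`.
          have n1 := e1 ▸ hex φ1 x h1
          have n2 := e2 ▸ hex φ2 x h2
          have n3 := e3 ▸ hex φ3 x h3
          have n4 := e4 ▸ hex φ4 x h4
          simp only [beq_eq_decide, hex φ x hx, n1, n2, n3, n4, decide_false, Bool.or_false,
            Bool.not_false]

end Search

/-! ### Running the search -/

theorem search_gem_cycle : cycleSearch gemForbidden gemTargets 100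
    (allTraces gemForbidden 5 cycleCode) = true := by
  decide +kernel

theorem search_coP3P2_cycle : cycleSearch coP3P2Forbidden coP3P2Targets 100
    (allTraces coP3P2Forbidden 5 cycleCode) = true := by
  decide +kernel

/-- No targets are needed: among the listed graphs only `K₄` has no induced 5-cycle, and it is
already forbidden. The code `[(0, 0)]` is a single vertex, on which the only traces are `0` and `1`.
-/
theorem search_gem_point :
    search (gemForbidden ++ rootedPatterns cycleAdj cycleOrders) [] 100 1 [(0, 0)] [0, 1] = true := by
  decide +kernel

theorem search_coP3P2_point :
    search (coP3P2Forbidden ++ rootedPatterns cycleAdj cycleOrders) [] 100 1 [(0, 0)] [0, 1] =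
      true := by
  decide +kernel

/-! ### Graphs given by adjacency lists -/

section AdjLists

/-- The adjacency lists are symmetric and loopless. -/
def IsProper {n : ℕ} (l : Fin n → List (Fin n)) : Prop :=
  ∀ i, ∀ j ∈ l i, i ∈ l j ∧ i ≠ j

instance {n : ℕ} (l : Fin n → List (Fin n)) : Decidable (IsProper l) :=
  inferInstanceAs (Decidable (∀ i, ∀ j ∈ l i, i ∈ l j ∧ i ≠ j))

theorem IsProper.adj_iff {n : ℕ} {l : Fin n → List (Fin n)} (hl : IsProper l) (i j : Fin n) :
    decide (j ∈ l i) = true ↔ (ofAdjLists l).Adj i j := by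
  rw [decide_eq_true_iff, ofAdjLists, SimpleGraph.fromRel_adj]
  constructor
  · exact fun h => ⟨(hl i j h).2, Or.inl h⟩
  · rintro ⟨-, h | h⟩
    · exact h
    · exact (hl j i h).1

theorem P5_eq : P5 = ofAdjLists pathAdj := by
  ext i j
  rw [SimpleGraph.pathGraph_adj]
  revert i j
  decide

theorem gem_eq : gem = ofAdjLists gemAdj := rfl

/-- The complement of `P₃ + P₂` in terms of adjacency lists. -/
def coP3P2Iso : coP3P2 ≃g ofAdjLists coP3P2Adj where
  toEquiv := finSumFinEquiv
  map_rel_iff' := by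
    rintro (a | a) (b | b) <;>
      simp only [coP3P2, SimpleGraph.compl_adj, SimpleGraph.sum_adj, SimpleGraph.pathGraph_adj,
        not_false_eq_true, and_true, ne_eq, reduceCtorEq, Sum.inl.injEq, Sum.inr.injEq] <;>
      revert a b <;> decide

theorem isFree_coP3P2_iff {V : Type*} {G : SimpleGraph V} :
    IsFree coP3P2 G ↔ IsFree (ofAdjLists coP3P2Adj) G :=
  not_congr ⟨fun ⟨φ⟩ => ⟨φ.comp coP3P2Iso.symm.toEmbedding⟩,
    fun ⟨φ⟩ => ⟨φ.comp coP3P2Iso.toEmbedding⟩⟩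

variable {V : Type*} [DecidableEq V] {G : SimpleGraph V} [DecidableRel G.Adj]

theorem avoidsRooted_of_isFree {n : ℕ} {l : Fin n → List (Fin n)} (hG : IsFree (ofAdjLists l) G)
    (hl : IsProper l) {os : List (Fin n × List (Fin n))}
    (hos : ∀ o ∈ os, ∀ p, p = o.1 ∨ p ∈ o.2) : ∀ P ∈ rootedPatterns l os, AvoidsRooted G P := by
  intro P hP vs x hx full c q hq ha
  obtain ⟨o, ho, rfl⟩ := List.mem_map.1 hP
  exact hG (isIndContained_of_agrees hl.adj_iff (hos o ho) hq hx ha)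

theorem avoids_of_isFree {n : ℕ} {l : Fin n → List (Fin n)} (hG : IsFree (ofAdjLists l) G)
    (hl : IsProper l) {root : Fin n} {ps : List (Fin n)} (hps : ∀ p, p ∈ ps) :
    Avoids G (listPattern l root ps) := fun _ _ _ =>
  List.eq_nil_iff_forall_not_mem.2 fun _ hq => hG (isIndContained_of_mem_copies hl.adj_iff hps hq)

theorem avoidsRooted_path (hG : IsFree P5 G) :
    ∀ P ∈ rootedPatterns pathAdj pathOrders, AvoidsRooted G P :=
  avoidsRooted_of_isFree (P5_eq ▸ hG) (by decide) (by decide)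

theorem avoidsRooted_gem (hG : IsFree gem G) :
    ∀ P ∈ rootedPatterns gemAdj gemOrders, AvoidsRooted G P :=
  avoidsRooted_of_isFree (gem_eq ▸ hG) (by decide) (by decide)

theorem avoidsRooted_coP3P2 (hG : IsFree coP3P2 G) :
    ∀ P ∈ rootedPatterns coP3P2Adj coP3P2Orders, AvoidsRooted G P :=
  avoidsRooted_of_isFree (isFree_coP3P2_iff.1 hG) (by decide) (by decide)

theorem avoidsRooted_complete (hG : IsFree (ofAdjLists completeAdj) G) :
    ∀ P ∈ rootedPatterns completeAdj completeOrders, AvoidsRooted G P :=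
  avoidsRooted_of_isFree hG (by decide) (by decide)

theorem avoidsRooted_cycle (hG : IsFree (ofAdjLists cycleAdj) G) :
    ∀ P ∈ rootedPatterns cycleAdj cycleOrders, AvoidsRooted G P :=
  avoidsRooted_of_isFree hG (by decide) (by decide)

/-- The two searches together show that there is no critical graph. -/
theorem not_isCritical {F T : List (List (Bool × List Bool))}
    (h1 : cycleSearch F T 100 (allTraces F 5 cycleCode) = true)
    (h2 : search (F ++ rootedPatterns cycleAdj cycleOrders) [] 100 1 [(0, 0)] [0, 1] = true)
    (hF : ∀ P ∈ F, AvoidsRooted G P) (hT : ∀ P ∈ T, Avoids G P) : ¬ IsCritical G := by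
  intro hG
  by_cases hc : (ofAdjLists cycleAdj).IsIndContained G
  · obtain ⟨φ⟩ := hc
    have := cycleSearch_sound hG hF hT φ 100 (allTraces F 5 cycleCode) fun ψ x hx => by
      have := trace_mem_allTraces hF hx
      rwa [code_cycleVertices] at this
    rw [h1] at this
    exact Bool.noConfusion this
  · have hne : Nonempty V := by
      by_contra h
      rw [not_nonempty_iff] at h
      exact hG.not_colorable ⟨fun _ => 0, fun x => h.elim x⟩
    obtain ⟨v⟩ := hne
    have hcode : code G [v] = [(0, 0)] := by simp [code, row, mask]
    have := search_sound (F := F ++ rootedPatterns cycleAdj cycleOrders) (T := []) hG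
      (fun P hP => (List.mem_append.1 hP).elim (hF P) (avoidsRooted_cycle hc P)) (by simp) 100 [v]
      (by simp) [0, 1] fun x _ => by
        have := mask_lt (fun w => decide (G.Adj x w)) [v]
        rw [trace]
        simp only [List.length_singleton, pow_one] at this
        interval_cases mask (fun w => decide (G.Adj x w)) [v] <;> simp
    rw [hcode, List.length_singleton, h2] at this
    exact Bool.noConfusion this

end AdjLists

/-! ### The listed graphs -/

/-- Graphs given by adjacency lists. -/
abbrev AdjLists : Type := Σ n : ℕ, Fin n → List (Fin n)

/-- The graph of adjacency lists. -/
def AdjLists.graph (X : AdjLists) : FinGraph := ⟨X.1, ofAdjLists X.2⟩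

/-- The adjacency lists of the listed graphs, in the gem-free case. -/
def gemFamily : List AdjLists := [⟨4, completeAdj⟩, ⟨7, spindleAdj⟩, ⟨10, tenAdj⟩]

/-- The adjacency lists of the listed graphs, in the second case. -/
def coP3P2Family : List AdjLists :=
  [⟨4, completeAdj⟩, ⟨6, wheelAdj⟩, ⟨7, spindleAdj⟩, ⟨7, crossedAdj⟩, ⟨7, denseAdj⟩, ⟨7, fannedAdj⟩]

theorem exists_mem_gemFamily {V : Type*} {G : SimpleGraph V} (hG : IsCritical G)
    (h1 : IsFree P5 G) (h2 : IsFree gem G) : ∃ X ∈ gemFamily, (ofAdjLists X.2).IsIndContained G := by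
  classical
  by_contra! h
  simp only [gemFamily, List.forall_mem_cons] at h
  obtain ⟨hk, hs, ht, -⟩ := h
  refine not_isCritical search_gem_cycle search_gem_point ?_ ?_ hG
  · simp only [gemForbidden, List.mem_append]
    rintro P ((hP | hP) | hP)
    · exact avoidsRooted_path h1 P hP
    · exact avoidsRooted_gem h2 P hP
    · exact avoidsRooted_complete hk P hP
  · simp only [gemTargets, List.forall_mem_cons]
    exact ⟨avoids_of_isFree hs (by decide) (by decide), avoids_of_isFree ht (by decide) (by decide),
      by simp⟩

theorem exists_mem_coP3P2Family {V : Type*} {G : SimpleGraph V} (hG : IsCritical G)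
    (h1 : IsFree P5 G) (h2 : IsFree coP3P2 G) :
    ∃ X ∈ coP3P2Family, (ofAdjLists X.2).IsIndContained G := by
  classical
  by_contra! h
  simp only [coP3P2Family, List.forall_mem_cons] at h
  obtain ⟨hk, hw, hs, hc, hd, hf, -⟩ := h
  refine not_isCritical search_coP3P2_cycle search_coP3P2_point ?_ ?_ hG
  · simp only [coP3P2Forbidden, List.mem_append]
    rintro P ((hP | hP) | hP)
    · exact avoidsRooted_path h1 P hP
    · exact avoidsRooted_coP3P2 h2 P hP
    · exact avoidsRooted_complete hk P hP
  · simp only [coP3P2Targets, List.forall_mem_cons]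
    exact ⟨avoids_of_isFree hw (by decide) (by decide), avoids_of_isFree hs (by decide) (by decide),
      avoids_of_isFree hc (by decide) (by decide), avoids_of_isFree hd (by decide) (by decide),
      avoids_of_isFree hf (by decide) (by decide), by simp⟩

/-- Whether no induced copy of the first graph in the second one is found. -/
noncomputable def noCopy (X Y : AdjLists) : Bool :=
  match X with
  -- There is no root to choose here; `false` asserts nothing.
  | ⟨0, _⟩ => false
  | ⟨n + 1, l⟩ => (copies (code (ofAdjLists Y.2) (List.finRange Y.1)) (fullMask Y.1)
      (listPattern l 0 (List.finRange (n + 1))) [] (fullMask Y.1) 0 0).isEmpty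

theorem isFree_of_noCopy {X Y : AdjLists} (hX : IsProper X.2) (h : noCopy X Y = true) :
    IsFree (ofAdjLists X.2) (ofAdjLists Y.2) := by
  obtain ⟨_ | n, l⟩ := X
  · simp [noCopy] at h
  rintro ⟨φ⟩
  obtain ⟨q, hq⟩ := exists_mem_copies hX.adj_iff φ 0 (List.mem_finRange) (List.finRange (n + 1)) []
    (List.nodup_finRange _) (by simp) 0 0
  rw [List.length_finRange, List.map_nil] at hq
  simp only [noCopy, List.isEmpty_iff] at h
  rw [listPattern] at h
  rw [h] at hq
  simp at hq

/-- Whether the graph is critical. -/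
noncomputable def checkCritical (X : AdjLists) : Bool :=
  !colorable (code (ofAdjLists X.2) (List.finRange X.1)) 1 0 0 0 &&
    (List.finRange X.1).all fun v =>
      colorable (code (ofAdjLists X.2) ((List.finRange X.1).erase v)) 1 0 0 0

theorem isCritical_of_check {X : AdjLists} (h : checkCritical X = true) :
    IsCritical (ofAdjLists X.2) := by
  rw [checkCritical, Bool.and_eq_true, Bool.not_eq_true', List.all_eq_true] at h
  refine ⟨?_, fun v => ?_⟩
  · have := h.1
    rw [← Bool.not_eq_true, colorable_code_iff (List.nodup_finRange _)] at this
    exact fun ⟨c, hc⟩ => this ⟨c, fun x _ y _ => hc x y⟩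
  · obtain ⟨c, hc⟩ := (colorable_code_iff ((List.nodup_finRange _).erase v)).1
      (h.2 v (List.mem_finRange v))
    refine ⟨c, fun x y hx hy => hc x ?_ y ?_⟩
    · exact (List.mem_erase_of_ne hx).2 (List.mem_finRange x)
    · exact (List.mem_erase_of_ne hy).2 (List.mem_finRange y)

/-- Whether the graphs of a family are critical, avoid `P₅` and the graph with adjacency lists `l`,
and are pairwise incomparable. -/
noncomputable def checkFamily (l : Fin 5 → List (Fin 5)) (A : List AdjLists) : Bool :=
  (A.all fun X => decide (IsProper X.2) && checkCritical X && noCopy ⟨5, pathAdj⟩ X &&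
    noCopy ⟨5, l⟩ X) && decide (A.Pairwise fun X Y => noCopy X Y = true)

theorem checkFamily_gem : checkFamily gemAdj gemFamily = true := by decide +kernel

theorem checkFamily_coP3P2 : checkFamily coP3P2Adj coP3P2Family = true := by decide +kernel

/-! ### Invariance under isomorphism and the final count -/

section Iso

variable {V W : Type*} {G : SimpleGraph V} {H : SimpleGraph W}

theorem IsCritical.of_iso (e : G ≃g H) (hH : IsCritical H) : IsCritical G := by
  refine ⟨fun ⟨c, hc⟩ => hH.not_colorable ⟨c ∘ e.symm, fun x y h => hc _ _ ?_⟩, fun v => ?_⟩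
  · exact e.symm.map_rel_iff.2 h
  · obtain ⟨c, hc⟩ := hH.exists_coloring (e v)
    exact ⟨c ∘ e, fun x y hx hy h => hc _ _ (fun h => hx (e.injective h))
      (fun h => hy (e.injective h)) (e.map_rel_iff.2 h)⟩

theorem IsFree.of_iso {U : Type*} {F : SimpleGraph U} (e : G ≃g H) (hH : IsFree F H) :
    IsFree F G := fun ⟨φ⟩ => hH ⟨e.toEmbedding.comp φ⟩

end Iso

/-- A graph is critical and avoids the forbidden graphs iff it is listed. -/
theorem isVertexCritical_iff_exists {V : Type*} {G : SimpleGraph V} {l : Fin 5 → List (Fin 5)}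
    {A : List AdjLists} (hl : IsProper l) (hA : checkFamily l A = true)
    (hex : IsCritical G → IsFree P5 G → IsFree (ofAdjLists l) G →
      ∃ X ∈ A, (ofAdjLists X.2).IsIndContained G) :
    (IsVertexCritical G 4 ∧ IsFree P5 G ∧ IsFree (ofAdjLists l) G) ↔
      ∃ H ∈ A.map AdjLists.graph, Nonempty (G ≃g H.2) := by
  rw [checkFamily, Bool.and_eq_true, List.all_eq_true] at hA
  rw [isVertexCritical_four_iff]
  constructor
  · rintro ⟨h1, h2, h3⟩
    obtain ⟨X, hX, hc⟩ := hex h1 h2 h3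
    have hX' := hA.1 X hX
    simp only [Bool.and_eq_true, decide_eq_true_iff] at hX'
    exact ⟨X.graph, List.mem_map_of_mem hX,
      h1.nonempty_iso (isCritical_of_check hX'.1.1.2).not_colorable hc⟩
  · rintro ⟨H, hH, ⟨e⟩⟩
    obtain ⟨X, hX, rfl⟩ := List.mem_map.1 hH
    have hX' := hA.1 X hX
    simp only [Bool.and_eq_true, decide_eq_true_iff] at hX'
    refine ⟨(isCritical_of_check hX'.1.1.2).of_iso e, IsFree.of_iso e ?_, IsFree.of_iso e ?_⟩
    · rw [P5_eq]
      exact isFree_of_noCopy (X := ⟨5, pathAdj⟩) (by decide) hX'.1.2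
    · exact isFree_of_noCopy (X := ⟨5, l⟩) hl hX'.2

/-- The number of isomorphism classes is the number of listed graphs. -/
theorem encard_classes {l : Fin 5 → List (Fin 5)} {A : List AdjLists}
    (hA : checkFamily l A = true) {S : Set (Quotient isoSetoid)}
    (hS : ∀ G : FinGraph, ⟦G⟧ ∈ S ↔ ∃ H ∈ A.map AdjLists.graph, Nonempty (G.2 ≃g H.2)) :
    S.encard = A.length := by
  classical
  rw [checkFamily, Bool.and_eq_true, List.all_eq_true, decide_eq_true_iff] at hA
  have hSe : S = ((A.map fun X => (⟦X.graph⟧ : Quotient isoSetoid)).toFinset : Set _) := by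
    ext c
    induction c using Quotient.inductionOn with
    | h G =>
      rw [hS, List.coe_toFinset, Set.mem_ofPred_eq, List.mem_map]
      constructor
      · rintro ⟨H, hH, hG⟩
        obtain ⟨X, hX, rfl⟩ := List.mem_map.1 hH
        exact ⟨X, hX, (Quotient.sound hG).symm⟩
      · rintro ⟨X, hX, hG⟩
        exact ⟨X.graph, List.mem_map_of_mem hX, Quotient.exact hG.symm⟩
  have hnd : (A.map fun X => (⟦X.graph⟧ : Quotient isoSetoid)).Nodup := by
    rw [List.Nodup, List.pairwise_map]
    refine hA.2.imp_of_mem fun {X Y} hX _ h heq => ?_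
    have hX' := hA.1 X hX
    simp only [Bool.and_eq_true, decide_eq_true_iff] at hX'
    obtain ⟨e⟩ : Nonempty (X.graph.2 ≃g Y.graph.2) := Quotient.exact heq
    -- An isomorphism would be an induced copy of the earlier graph in the later one.
    exact isFree_of_noCopy hX'.1.1.1 h ⟨e.toEmbedding⟩
  rw [hSe, Set.encard_coe_eq_coe_finsetCard, List.toFinset_card_of_nodup hnd, List.length_map]

/-- Membership of a class only provides some representative with the property, so the equivalence is
required for every graph isomorphic to `G`. -/
theorem mem_criticalClasses_iff {W : Type*} {H : SimpleGraph W} {k : ℕ} {G : FinGraph}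
    (P : Prop) (hP : ∀ G' : FinGraph, Nonempty (G.2 ≃g G'.2) →
      ((IsVertexCritical G'.2 k ∧ IsFree P5 G'.2 ∧ IsFree H G'.2) ↔ P)) :
    ⟦G⟧ ∈ criticalClasses k H ↔ P := by
  constructor
  · rintro ⟨G', h1, h2, h3, h4⟩
    exact (hP G' (Quotient.exact h4)).1 ⟨h1, h2, h3⟩
  · intro h
    obtain ⟨h1, h2, h3⟩ := (hP G ⟨SimpleGraph.Iso.refl⟩).2 h
    exact ⟨G, h1, h2, h3, rfl⟩

theorem exists_iso_congr {V W : Type*} {G : SimpleGraph V} {G' : SimpleGraph W} (e : G ≃g G')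
    (B : List FinGraph) :
    (∃ H ∈ B, Nonempty (G' ≃g H.2)) ↔ ∃ H ∈ B, Nonempty (G ≃g H.2) :=
  exists_congr fun _ => and_congr_right fun _ =>
    ⟨fun ⟨f⟩ => ⟨e.trans f⟩, fun ⟨f⟩ => ⟨e.symm.trans f⟩⟩

theorem gem_iff {V : Type*} (G : SimpleGraph V) :
    (IsVertexCritical G 4 ∧ IsFree P5 G ∧ IsFree gem G) ↔ ∃ H ∈ gemList, Nonempty (G ≃g H.2) :=
  -- By unfolding, `gem` is `ofAdjLists gemAdj` and `gemList` is `gemFamily.map AdjLists.graph`.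
  isVertexCritical_iff_exists (by decide) checkFamily_gem exists_mem_gemFamily

theorem coP3P2_iff {V : Type*} (G : SimpleGraph V) :
    (IsVertexCritical G 4 ∧ IsFree P5 G ∧ IsFree coP3P2 G) ↔
      ∃ H ∈ coP3P2List, Nonempty (G ≃g H.2) := by
  rw [isFree_coP3P2_iff]
  exact isVertexCritical_iff_exists (by decide) checkFamily_coP3P2 fun h1 h2 h3 =>
    exists_mem_coP3P2Family h1 h2 (isFree_coP3P2_iff.2 h3)

end VertexCritical

theorem theorem3p3 :
    ((VertexCritical.criticalClasses 4 VertexCritical.gem).encard = 3 ∧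
      ∀ (V : Type*) [Finite V] (G : SimpleGraph V),
        (VertexCritical.IsVertexCritical G 4 ∧ VertexCritical.IsFree VertexCritical.P5 G ∧
            VertexCritical.IsFree VertexCritical.gem G) ↔
          ∃ H ∈ VertexCritical.gemList, Nonempty (G ≃g H.2)) ∧
    ((VertexCritical.criticalClasses 4 VertexCritical.coP3P2).encard = 6 ∧
      ∀ (V : Type*) [Finite V] (G : SimpleGraph V),
        (VertexCritical.IsVertexCritical G 4 ∧ VertexCritical.IsFree VertexCritical.P5 G ∧
            VertexCritical.IsFree VertexCritical.coP3P2 G) ↔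
          ∃ H ∈ VertexCritical.coP3P2List, Nonempty (G ≃g H.2)) := by
  refine ⟨⟨?_, fun V _ G => VertexCritical.gem_iff G⟩,
    ⟨?_, fun V _ G => VertexCritical.coP3P2_iff G⟩⟩
  · exact VertexCritical.encard_classes VertexCritical.checkFamily_gem fun G =>
      VertexCritical.mem_criticalClasses_iff _ fun G' ⟨e⟩ =>
        (VertexCritical.gem_iff G'.2).trans (VertexCritical.exists_iso_congr e _)
  · exact VertexCritical.encard_classes VertexCritical.checkFamily_coP3P2 fun G =>
      VertexCritical.mem_criticalClasses_iff _ fun G' ⟨e⟩ =>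
        (VertexCritical.coP3P2_iff G'.2).trans (VertexCritical.exists_iso_congr e _)
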